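/- Let $I\subseteq\mathbb R$ be a nonempty open interval (bounded or not) and $J=I\times\{0\}\subset\mathbb R^2_{\tau,\phi}$. A domain $W$ (nonempty, open, connected) contained in $\{\phi>0\}$ is called *adjacent to $J$* if every point of $J$ has a neighbourhood whose intersection with $\{\phi>0\}$ lies in $W$. A function $f$ on $W\cup J$ is called *$\phi$-flat* (written $f=\operatorname{flat}(\phi)$) if it is $C^\infty$ on $W\cup J$ (up to the boundary), $f|_J\equiv 0$, and $f$ and each of its partial derivatives tend to $0$ as $\phi\to0$, uniformly for $\tau$ in compact subsets of $I$. Let $V\subset\{\phi>0\}$ be a domain adjacent to $J$ and let $\widetilde F:V\cup J\to\mathbb R\times\mathbb R_{\ge0}$ be a $C^\infty$ map of the form $$\widetilde F(\tau,\phi)=(\tau+\phi+\operatorname{flat}(\phi),\ \phi+\operatorname{flat}(\phi)).$$ (No area preservation is assumed.) A function $f$ on $W\cup J$, $W\subseteq V$, is called *$\widetilde F$-invariant* if $f(\widetilde F(x))=f(x)$ whenever $x,\widetilde F(x)\in W\cup J$. Then: 1) There exist a domain $W\subseteq V$ adjacent to $J$ and an $\widetilde F$-invariant $C^\infty$ function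 $\widetilde\phi$ on $W\cup J$ with $\widetilde\phi=\phi+\operatorname{flat}(\phi)$ and $\partial\widetilde\phi/\partial\phi>0$ on $W\cup J$. 2) For every domain $W\subseteq V$ adjacent to $J$ and every function $\widetilde\phi$ on $W\cup J$ as in 1), there exist a domain $W'\subseteq W$ adjacent to $J$ and a $C^\infty$ function $\widetilde\tau=\tau+\operatorname{flat}(\phi)$ on $W'\cup J$ such that $(\tau,\phi)\mapsto(\widetilde\tau,\widetilde\phi)$ is a $C^\infty$ diffeomorphism of $W'\cup J$ onto its image that conjugates $\widetilde F$ to $(\widetilde\tau,\widetilde\phi)\mapsto(\widetilde\tau+\widetilde\phi,\widetilde\phi)$, i.e. $\widetilde\tau(\widetilde F(x))=\widetilde\tau(x)+\widetilde\phi(x)$ and $\widetilde\phi(\widetilde F(x))=\widetilde\phi(x)$ whenever $x,\widetilde F(x)\in W'\cup J$. 3) There exist a single domain $W\subseteq V$ adjacent to $J$ and a set $\mathcal S$, of the cardinality of the continuum, of functions $\widetilde\phi$ satisfying 1) on $W\cup J$, such that the corresponding $C^\infty$ foliations $\widetilde\phi=\mathrm{const}$ of $W\cup J$ (with leaves the connected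 components of the level sets) form an infinite-dimensional family with distinct boundary germs, that is: for any two distinct elements of $\mathcal S$ the germs of the two foliations at every point of $J$ are distinct (on no neighbourhood of the point do the restricted foliations have the same leaves); and for every $N\in\mathbb N$ the set $\mathcal S$ contains an $N$-parametric family $(g_c)_{c\in[0,1]^N}$ with $c\mapsto g_c$ injective and $g_c(x)$ of class $C^\infty$ in $(c,x)\in[0,1]^N\times(W\cup J)$. -/

import Mathlib

open Set
open scoped ContDiff Topology Cardinal

/-- The boundary interval `J = I × {0}` in the plane with coordinates `(τ, φ)`. -/
def bdry (I : Set ℝ) : Set (ℝ × ℝ) := {x | x.1 ∈ I ∧ x.2 = 0}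

/-- `W` is a domain (open, connected) of the open half-plane `φ > 0` that is adjacent to `I × {0}`:
every point of `I × {0}` has a neighbourhood whose part in `φ > 0` lies in `W`. -/
structure IsAdjacentDomain (I : Set ℝ) (W : Set (ℝ × ℝ)) : Prop where
  isOpen : IsOpen W
  isConnected : IsConnected W
  pos : ∀ x ∈ W, 0 < x.2
  adjacent : ∀ t ∈ I, W ∈ 𝓝[{x : ℝ × ℝ | 0 < x.2}] ((t, 0) : ℝ × ℝ)

/-- `f` is `φ`-flat on `W ∪ J`, `J = I × {0}`: it is smooth on `W ∪ J` (up to the boundary),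
vanishes on `J`, and tends to zero as `φ → 0` together with all its partial derivatives (all partial
derivatives of order `n` are controlled by the norm of the `n`-th Fréchet derivative), for each
individual order uniformly on compact subsets of the `τ`-interval `I`. -/
structure IsFlat (I : Set ℝ) (W : Set (ℝ × ℝ)) (f : ℝ × ℝ → ℝ) : Prop where
  smooth : ContDiffOn ℝ ∞ f (W ∪ bdry I)
  zero : ∀ x ∈ bdry I, f x = 0
  decay : ∀ (n : ℕ) (K : Set ℝ), IsCompact K → K ⊆ I → ∀ ε > 0, ∃ δ > 0,
    ∀ s ∈ K, ∀ y : ℝ, 0 < y → y < δ → (s, y) ∈ W → ‖iteratedFDeriv ℝ n f (s, y)‖ < ε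

/-- `f` is invariant under the (partially defined) map `F` on `S`. -/
def IsInvariantOn (F : ℝ × ℝ → ℝ × ℝ) (S : Set (ℝ × ℝ)) (f : ℝ × ℝ → ℝ) : Prop :=
  ∀ x ∈ S, F x ∈ S → f (F x) = f x

/-- `f` is a smooth `F`-invariant function on `W ∪ J` of the type `φ + flat(φ)`, with
`∂f/∂φ > 0` on `W ∪ J` (a one-sided derivative at the points of `J`). Thus `f` vanishes on `J`, and
`f = const` is a smooth foliation of `W ∪ J` by `F`-invariant curves. -/
structure IsFlatIntegral (F : ℝ × ℝ → ℝ × ℝ) (I : Set ℝ) (W : Set (ℝ × ℝ))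
    (f : ℝ × ℝ → ℝ) : Prop where
  smooth : ContDiffOn ℝ ∞ f (W ∪ bdry I)
  flat : IsFlat I W (fun x => f x - x.2)
  deriv_pos : ∀ x ∈ W ∪ bdry I, 0 < fderivWithin ℝ f (W ∪ bdry I) x (0, 1)
  invariant : IsInvariantOn F (W ∪ bdry I) f

/-- `H` is a smooth diffeomorphism of `S` onto its image. -/
def IsSmoothDiffeoOn (H : ℝ × ℝ → ℝ × ℝ) (S : Set (ℝ × ℝ)) : Prop :=
  ContDiffOn ℝ ∞ H S ∧ ∃ G : ℝ × ℝ → ℝ × ℝ, ContDiffOn ℝ ∞ G (H '' S) ∧ LeftInvOn G H S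

/-- The leaf through `x` of the foliation `f = const` of `S`: the connected component containing `x`
of the level set of `f` in `S`. -/
def leafThrough (S : Set (ℝ × ℝ)) (f : ℝ × ℝ → ℝ) (x : ℝ × ℝ) : Set (ℝ × ℝ) :=
  connectedComponentIn {y | y ∈ S ∧ f y = f x} x

/-- The foliations `f = const` and `g = const` of `S` have the same germ at `p`: their restrictions
to some neighbourhood of `p` have the same leaves. -/
def SameFoliationGerm (S : Set (ℝ × ℝ)) (f g : ℝ × ℝ → ℝ) (p : ℝ × ℝ) : Prop :=
  ∃ U : Set (ℝ × ℝ), IsOpen U ∧ p ∈ U ∧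
    ∀ x ∈ S ∩ U, leafThrough (S ∩ U) f x = leafThrough (S ∩ U) g x

/-- The foliations `f = const`, `f ∈ 𝒮`, of `W ∪ J` form an infinite-dimensional family with
distinct boundary germs: any two of them have distinct germs at each point of `J`, and for every `N`
the collection contains a smooth `N`-parametric family of (pairwise distinct) foliations. -/
structure IsInfDimFamily (I : Set ℝ) (W : Set (ℝ × ℝ)) (𝒮 : Set (ℝ × ℝ → ℝ)) : Prop where
  distinct : ∀ f ∈ 𝒮, ∀ g ∈ 𝒮, f ≠ g → ∀ p ∈ bdry I, ¬ SameFoliationGerm (W ∪ bdry I) f g p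
  families : ∀ N : ℕ, ∃ g : (Fin N → ℝ) → (ℝ × ℝ → ℝ),
    (∀ c ∈ Icc (0 : Fin N → ℝ) 1, g c ∈ 𝒮) ∧
    InjOn g (Icc (0 : Fin N → ℝ) 1) ∧
    ContDiffOn ℝ ∞ (fun p : (Fin N → ℝ) × (ℝ × ℝ) => g p.1 p.2)
      (Icc (0 : Fin N → ℝ) 1 ×ˢ (W ∪ bdry I))

/-!
The three assertions reduce to one cohomological equation. Extended by zero to `φ ≤ 0`, a `φ`-flat
function is the same as a germ along `J` of a smooth function on the plane (`IsFlat.flatGerm`,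
`FlatGerm.isFlat`). An invariant function `φ + u` amounts to `u ∘ F - u = φ - φ ∘ F`, and for a given
invariant `f` a conjugating coordinate `τ + v` amounts to `v ∘ F - v = τ + f - τ ∘ F`. In both cases
the right-hand side `g` is flat, and `exists_flatGerm_coboundary` provides a flat solution.

To solve `v ∘ F - v = g`, the flat data are replaced by functions on the whole plane with bounded
derivatives that have the same germs along `J` and vanish where `|τ| φ ≥ 1`
(`FlatGerm.exists_globalFlat`: a partition of unity on `I` and cutoffs at rapidly decreasing heights).
Then each orbit starting near `J` in `φ > 0` moves to the right and leaves the support of `g` after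
at most `φ ^ (-3)` steps, so that `v = -∑ g ∘ F ^ n` is a finite sum there. The point is its
smoothness at `φ = 0`. Naive bounds for the derivatives of `F ^ n` are exponential in `1/φ`, hence
useless against an arbitrary flat `g`. But `F` is a flat perturbation of a unipotent linear map, and an orbit shadows the linear one with a flat
error for as long as it matters (`TameFlat.exists_shadowing`), so orbits grow polynomially in `1/φ`
only. This class of maps is stable under `F ↦ TF`, `TF(z, w) = (F z, DF(z) w)`
(`IsShearSystem.tangent`), and the differential of the orbit sum of `(F, g)` is the orbit sum of
`(TF, Dg)` (`IsShearSystem.orbitSum_interior`). Hence the `C^0` estimate, applied to iterated tangent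
maps, gives smoothness of all orders (`IsShearSystem.contDiffAt_boundary`).

The coordinates `(τ~, φ~)` extend to a diffeomorphism of the plane, the identity plus a
contraction (`FlatGerm.exists_homeomorph`). In these coordinates the functions
`φ + exp(-1/φ) h(τ/φ)`, with `h` smooth and of period one, are invariant under the shear. A leaf of
such a foliation near a point of `J` runs through a full period of `θ = τ/φ`; normalizing `h(0) = 0`
makes two such functions agree where `θ` is an integer, so the leaf determines `h`
(`eq_of_sameFoliationGerm`). Polynomials in `sin(2πθ)` without constant term supply the
finite-dimensional smooth families.
-/

/-! ### Flat perturbations of unipotent linear maps and their orbits -/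

/-- `R : E → G` is smooth, vanishes on the half-space `ℓ ≤ 0`, and every derivative of `R` is
`O(ℓ ^ m)` for all `m`, uniformly on each region `‖z‖ ≤ ℓ(z) ^ (-q)`. The latter regions are allowed
because the orbits of a shear reach distances of the order of a negative power of `ℓ` while they
matter, and because the class has to be stable under `R ↦ ((z, w) ↦ DR(z) w)`. -/
structure TameFlat {E G : Type} [NormedAddCommGroup E] [NormedSpace ℝ E]
    [NormedAddCommGroup G] [NormedSpace ℝ G] (ℓ : E →L[ℝ] ℝ) (R : E → G) : Prop where
  smooth : ContDiff ℝ ∞ R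
  zero : ∀ z, ℓ z ≤ 0 → R z = 0
  bound : ∀ i q m : ℕ, ∃ C : ℝ, ∀ z, 0 < ℓ z → ℓ z ≤ 1 → ‖z‖ * ℓ z ^ q ≤ 1 →
    ‖iteratedFDeriv ℝ i R z‖ ≤ C * ℓ z ^ m

section Tangent

variable {E G : Type} [NormedAddCommGroup E] [NormedSpace ℝ E]
    [NormedAddCommGroup G] [NormedSpace ℝ G]

theorem TameFlat.bound_nonneg {ℓ : E →L[ℝ] ℝ} {R : E → G} (h : TameFlat ℓ R) (i q m : ℕ) :
    ∃ C : ℝ, 0 ≤ C ∧ ∀ z, 0 < ℓ z → ℓ z ≤ 1 → ‖z‖ * ℓ z ^ q ≤ 1 →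
      ‖iteratedFDeriv ℝ i R z‖ ≤ C * ℓ z ^ m := by
  obtain ⟨C, hC⟩ := h.bound i q m
  refine ⟨max C 0, le_max_right _ _, fun z h1 h2 h3 => (hC z h1 h2 h3).trans ?_⟩
  gcongr
  exact le_max_left _ _

theorem TameFlat.prodMk {G' : Type} [NormedAddCommGroup G'] [NormedSpace ℝ G']
    {ℓ : E →L[ℝ] ℝ} {R : E → G} {S : E → G'} (hR : TameFlat ℓ R) (hS : TameFlat ℓ S) :
    TameFlat ℓ (fun z => (R z, S z)) := by
  refine ⟨hR.smooth.prodMk hS.smooth, fun z hz => by simp [hR.zero z hz, hS.zero z hz], ?_⟩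
  intro i q m
  obtain ⟨C, hC⟩ := hR.bound i q m
  obtain ⟨D, hD⟩ := hS.bound i q m
  refine ⟨max C D, fun z h1 h2 h3 => ?_⟩
  rw [iteratedFDeriv_prodMk hR.smooth.contDiffAt hS.smooth.contDiffAt (by exact_mod_cast le_top),
    ContinuousMultilinearMap.opNorm_prod]
  have hp : 0 ≤ ℓ z ^ m := by positivity
  refine max_le ((hC z h1 h2 h3).trans ?_) ((hD z h1 h2 h3).trans ?_)
  · exact mul_le_mul_of_nonneg_right (le_max_left _ _) hp
  · exact mul_le_mul_of_nonneg_right (le_max_right _ _) hp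

theorem norm_iteratedFDeriv_comp_fst_le {f : E → G} (hf : ContDiff ℝ ∞ f) (i : ℕ) (p : E × E) :
    ‖iteratedFDeriv ℝ i (fun p : E × E => f p.1) p‖ ≤ ‖iteratedFDeriv ℝ i f p.1‖ := by
  have h := (ContinuousLinearMap.fst ℝ E E).iteratedFDeriv_comp_right hf p
    (i := i) (by exact_mod_cast le_top)
  change iteratedFDeriv ℝ i (fun p : E × E => f p.1) p = _ at h
  rw [h]
  refine (ContinuousMultilinearMap.norm_compContinuousLinearMap_le _ _).trans ?_
  refine mul_le_of_le_one_right (norm_nonneg _) ?_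
  exact Finset.prod_le_one (fun _ _ => norm_nonneg _) fun _ _ => ContinuousLinearMap.norm_fst_le ..

theorem norm_iteratedFDeriv_snd_le (i : ℕ) (p : E × E) :
    ‖iteratedFDeriv ℝ i (fun p : E × E => p.2) p‖ ≤ 1 + ‖p‖ := by
  match i with
  | 0 =>
    rw [norm_iteratedFDeriv_zero]
    linarith [norm_snd_le p]
  | 1 =>
    rw [← norm_iteratedFDeriv_fderiv, norm_iteratedFDeriv_zero]
    have : fderiv ℝ (fun p : E × E => p.2) p = ContinuousLinearMap.snd ℝ E E := fderiv_snd
    rw [this]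
    linarith [ContinuousLinearMap.norm_snd_le ℝ E E, norm_nonneg p]
  | k + 2 =>
    rw [← norm_iteratedFDeriv_fderiv]
    have : fderiv ℝ (fun p : E × E => p.2) = fun _ => ContinuousLinearMap.snd ℝ E E := by
      ext1 p; exact fderiv_snd
    rw [this, iteratedFDeriv_const_of_ne (by omega)]
    simp; positivity

theorem TameFlat.comp_fst {ℓ : E →L[ℝ] ℝ} {R : E → G} (h : TameFlat ℓ R) :
    TameFlat (ℓ.comp (ContinuousLinearMap.fst ℝ E E)) (fun p : E × E => R p.1) := by
  refine ⟨h.smooth.comp contDiff_fst, fun z hz => h.zero _ hz, fun i q m => ?_⟩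
  obtain ⟨C, hC⟩ := h.bound i q m
  refine ⟨C, fun z h1 h2 h3 => ?_⟩
  exact (norm_iteratedFDeriv_comp_fst_le h.smooth i z).trans
    (hC z.1 h1 h2 ((mul_le_mul_of_nonneg_right (norm_fst_le z) (pow_nonneg h1.le _)).trans h3))

/-- The differential of a tame flat map is tame flat on the tangent space. -/
theorem TameFlat.fderiv_apply {ℓ : E →L[ℝ] ℝ} {R : E → G} (h : TameFlat ℓ R) :
    TameFlat (ℓ.comp (ContinuousLinearMap.fst ℝ E E)) (fun p : E × E => fderiv ℝ R p.1 p.2) := by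
  have hd : ContDiff ℝ ∞ (fderiv ℝ R) := h.smooth.fderiv_right (by simp)
  have hd1 : ContDiff ℝ ∞ (fun p : E × E => fderiv ℝ R p.1) := hd.comp contDiff_fst
  refine ⟨hd1.clm_apply contDiff_snd, fun p hp => ?_, fun i q m => ?_⟩
  · -- at `ℓ = 0` the derivative vanishes as a limit of derivatives over `ℓ < 0`
    have hp' : ℓ p.1 ≤ 0 := hp
    by_cases hl : ℓ = 0
    · have : R = fun _ => 0 := by ext z; exact h.zero z (by simp [hl])
      simp [this]
    obtain ⟨e, he⟩ : ∃ e, ℓ e ≠ 0 := by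
      by_contra! hc
      exact hl (ContinuousLinearMap.ext hc)
    have he' : 0 < ℓ ((ℓ e) • e) := by
      simpa using mul_self_pos.mpr he
    set e' := (ℓ e) • e
    have hT : Filter.Tendsto (fun t : ℝ => fderiv ℝ R (p.1 - t • e')) (𝓝[>] 0)
        (𝓝 (fderiv ℝ R p.1)) := by
      have hc : Continuous (fun t : ℝ => fderiv ℝ R (p.1 - t • e')) :=
        hd.continuous.comp (by fun_prop)
      have := (hc.tendsto 0).mono_left (nhdsWithin_le_nhds (s := Ioi 0))
      simpa using this
    have h0 : ∀ᶠ t : ℝ in 𝓝[>] 0, fderiv ℝ R (p.1 - t • e') = 0 := by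
      filter_upwards [self_mem_nhdsWithin] with t ht
      have hneg : ℓ (p.1 - t • e') < 0 := by
        have : 0 < t * ℓ e' := mul_pos ht he'
        simp only [map_sub, map_smul, smul_eq_mul]
        linarith
      have : R =ᶠ[𝓝 (p.1 - t • e')] fun _ => 0 := by
        filter_upwards [(ℓ.continuous.isOpen_preimage _ isOpen_Iio).mem_nhds hneg] with z hz
        exact h.zero z (le_of_lt hz)
      rw [this.fderiv_eq]; simp
    have : fderiv ℝ R p.1 = 0 :=
      tendsto_nhds_unique (hT.congr' h0) tendsto_const_nhds
    simp [this]
  · have hb : ∀ j, ∃ C : ℝ, 0 ≤ C ∧ ∀ z, 0 < ℓ z → ℓ z ≤ 1 → ‖z‖ * ℓ z ^ q ≤ 1 →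
      ‖iteratedFDeriv ℝ j R z‖ ≤ C * ℓ z ^ (m + q) := fun j => h.bound_nonneg j q (m + q)
    choose C hC0 hC using hb
    refine ⟨∑ j ∈ Finset.range (i + 1), (i.choose j : ℝ) * C (j + 1) * 2, fun p h1 h2 h3 => ?_⟩
    have h1' : 0 < ℓ p.1 := h1
    have h2' : ℓ p.1 ≤ 1 := h2
    have h3' : ‖p‖ * ℓ p.1 ^ q ≤ 1 := h3
    refine (norm_iteratedFDeriv_clm_apply hd1 contDiff_snd p (n := i)
      (by exact_mod_cast le_top)).trans ?_
    change _ ≤ _ * ℓ p.1 ^ m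
    rw [Finset.sum_mul]
    refine Finset.sum_le_sum fun j _ => ?_
    have hz : ‖p.1‖ * ℓ p.1 ^ q ≤ 1 := le_trans (by gcongr; exact norm_fst_le p) h3'
    have e1 : ‖iteratedFDeriv ℝ j (fun p : E × E => fderiv ℝ R p.1) p‖
        ≤ C (j + 1) * ℓ p.1 ^ (m + q) := by
      refine (norm_iteratedFDeriv_comp_fst_le hd j p).trans ?_
      rw [norm_iteratedFDeriv_fderiv]
      exact hC _ _ h1' h2' hz
    have e2 := norm_iteratedFDeriv_snd_le (i - j) p
    have e3 : ℓ p.1 ^ q * (1 + ‖p‖) ≤ 2 := by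
      have : ℓ p.1 ^ q ≤ 1 := pow_le_one₀ h1'.le h2'
      nlinarith
    have hpm : 0 ≤ ℓ p.1 ^ m := by positivity
    have hpq : 0 ≤ ℓ p.1 ^ q := by positivity
    calc _ ≤ (i.choose j : ℝ) * (C (j + 1) * ℓ p.1 ^ (m + q)) * (1 + ‖p‖) := by
          gcongr
          have := hC0 (j + 1)
          positivity
      _ = (i.choose j : ℝ) * C (j + 1) * ℓ p.1 ^ m * (ℓ p.1 ^ q * (1 + ‖p‖)) := by ring
      _ ≤ (i.choose j : ℝ) * C (j + 1) * ℓ p.1 ^ m * 2 := by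
          have := hC0 (j + 1)
          gcongr
      _ = _ := by ring

end Tangent

section Orbits

variable {E : Type} [NormedAddCommGroup E] [NormedSpace ℝ E]

/-- Variation of constants: a perturbation of size `ρ` of a linear map with `‖L ^ n‖ ≤ n + 1` moves
an orbit of length `n` by at most `n ^ 2 ρ`. The extra exponent `a` makes the induction work. -/
theorem norm_pow_apply_iterate_sub_le {L : E →L[ℝ] E} (hL : ∀ n : ℕ, ‖L ^ n‖ ≤ n + 1) {R : E → E}
    {z : E} {ρ : ℝ} (n a : ℕ) (hρ : 0 ≤ ρ)
    (h : ∀ j < n, ‖R ((fun y => L y + R y)^[j] z)‖ ≤ ρ) :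
    ‖(L ^ a) ((fun y => L y + R y)^[n] z - (L ^ n) z)‖ ≤ n * (n + a) * ρ := by
  induction n generalizing a with
  | zero => simp
  | succ n ih =>
    have ih' := ih (a + 1) fun j hj => h j (by omega)
    have e : (L ^ a) ((fun y => L y + R y)^[n + 1] z - (L ^ (n + 1)) z) =
        (L ^ (a + 1)) ((fun y => L y + R y)^[n] z - (L ^ n) z) +
          (L ^ a) (R ((fun y => L y + R y)^[n] z)) := by
      rw [Function.iterate_succ_apply', pow_succ' L n, pow_succ L a]
      simp only [mul_apply_eq_comp, map_sub, map_add]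
      abel
    rw [e]
    have h2 : ‖(L ^ a) (R ((fun y => L y + R y)^[n] z))‖ ≤ (a + 1) * ρ :=
      ((L ^ a).le_opNorm _).trans (mul_le_mul (hL a) (h n (by omega)) (norm_nonneg _)
        (by positivity))
    refine (norm_add_le _ _).trans ((add_le_add ih' h2).trans ?_)
    push_cast
    nlinarith [mul_nonneg (Nat.cast_nonneg (α := ℝ) n) hρ,
      mul_nonneg (Nat.cast_nonneg (α := ℝ) a) hρ]

/-- Orbits of a flat perturbation `L + R` starting at `z` shadow the linear orbit for `ℓ(z) ^ (-4)`
steps, with an error smaller than any prescribed power of `ℓ(z)`. -/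
theorem TameFlat.exists_shadowing {ℓ : E →L[ℝ] ℝ} {L : E →L[ℝ] E} (hℓL : ∀ z, ℓ (L z) = ℓ z)
    (hL : ∀ n : ℕ, ‖L ^ n‖ ≤ n + 1) {R : E → E} (hR : TameFlat ℓ R) (M : ℝ) (hM : 0 ≤ M) (k : ℕ) :
    ∃ δ > 0, δ ≤ 1 ∧ ∀ z, ‖z‖ ≤ M → 0 < ℓ z → ℓ z < δ → ∀ n : ℕ, n * ℓ z ^ 4 ≤ 1 →
      ‖(fun y => L y + R y)^[n] z - (L ^ n) z‖ ≤ ℓ z ^ (k + 2) ∧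
      ℓ z / 2 ≤ ℓ ((fun y => L y + R y)^[n] z) ∧ ℓ ((fun y => L y + R y)^[n] z) ≤ 2 * ℓ z ∧
      ‖(fun y => L y + R y)^[n] z‖ * ℓ ((fun y => L y + R y)^[n] z) ^ 5 ≤ 1 := by
  obtain ⟨C, hC0, hC⟩ := hR.bound_nonneg 0 5 (k + 11)
  have hpos : 0 < 1 / (2 * ‖ℓ‖ + 2 + 32 * (2 * M + 1) + C * 2 ^ (k + 11)) := by positivity
  set δ := 1 / (2 * ‖ℓ‖ + 2 + 32 * (2 * M + 1) + C * 2 ^ (k + 11)) with hδ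
  have hδD : δ * (2 * ‖ℓ‖ + 2 + 32 * (2 * M + 1) + C * 2 ^ (k + 11)) = 1 := by
    rw [hδ]; field_simp
  have hℓLn : ∀ (n : ℕ) z, ℓ ((L ^ n) z) = ℓ z := by
    intro n z
    induction n with
    | zero => simp
    | succ n ih => rw [pow_succ', mul_apply_eq_comp, hℓL, ih]
  have hCk : 0 ≤ C * 2 ^ (k + 11) := by positivity
  have hδ2 : δ ≤ 1 / 2 := by
    rw [hδ]; apply one_div_le_one_div_of_le (by norm_num); nlinarith [norm_nonneg ℓ]
  refine ⟨δ, hpos, by linarith, fun z hz hs hsδ => ?_⟩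
  set s := ℓ z with hsdef
  have hs1 : s ≤ 1 := by linarith
  have hsD : s * (2 * ‖ℓ‖ + 2 + 32 * (2 * M + 1) + C * 2 ^ (k + 11)) ≤ 1 := by
    exact (mul_le_mul_of_nonneg_right hsδ.le (by positivity)).trans hδD.le
  have hsℓ : s * ‖ℓ‖ ≤ 1 / 2 := by nlinarith [mul_nonneg hs.le hM, mul_nonneg hs.le hCk]
  have hsM : 32 * (2 * M + 1) * s ≤ 1 := by
    nlinarith [mul_nonneg hs.le (norm_nonneg ℓ), mul_nonneg hs.le hCk]
  have hsC : C * 2 ^ (k + 11) * s ≤ 1 := by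
    nlinarith [mul_nonneg hs.le (norm_nonneg ℓ), mul_nonneg hs.le hM]
  intro n
  induction n using Nat.strong_induction_on with
  | _ n ih =>
  intro hn
  set Φ : E → E := fun y => L y + R y with hΦ
  have hρ : ∀ j < n, ‖R (Φ^[j] z)‖ ≤ C * 2 ^ (k + 11) * s ^ (k + 11) := by
    intro j hj
    have hjn : (j : ℝ) * s ^ 4 ≤ 1 := le_trans (by gcongr) hn
    obtain ⟨-, h2, h3, h4⟩ := ih j hj hjn
    have := hC (Φ^[j] z) (by linarith) (by linarith) h4
    rw [norm_iteratedFDeriv_zero] at this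
    refine this.trans ?_
    calc C * ℓ (Φ^[j] z) ^ (k + 11) ≤ C * (2 * s) ^ (k + 11) := by
          gcongr
          linarith
      _ = _ := by rw [mul_pow]; ring
  have h1 : ‖Φ^[n] z - (L ^ n) z‖ ≤ s ^ (k + 2) := by
    have := norm_pow_apply_iterate_sub_le hL n 0 (by positivity) hρ
    simp only [pow_zero, one_apply_eq_self, Nat.cast_zero, add_zero] at this
    refine this.trans ?_
    calc (n : ℝ) * n * (C * 2 ^ (k + 11) * s ^ (k + 11))
        = (n * s ^ 4) * (n * s ^ 4) * (C * 2 ^ (k + 11) * s) * s ^ (k + 2) := by ring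
      _ ≤ 1 * 1 * 1 * s ^ (k + 2) := by gcongr
      _ = _ := by ring
  have hsk : s ^ (k + 2) ≤ s ^ 2 := pow_le_pow_of_le_one hs.le hs1 (by omega)
  have hℓn : |ℓ (Φ^[n] z) - s| ≤ s / 2 := by
    have e : ℓ (Φ^[n] z) - s = ℓ (Φ^[n] z - (L ^ n) z) := by rw [map_sub, hℓLn]
    rw [e, ← Real.norm_eq_abs]
    calc _ ≤ ‖ℓ‖ * ‖Φ^[n] z - (L ^ n) z‖ := ℓ.le_opNorm _
      _ ≤ ‖ℓ‖ * s ^ 2 := by gcongr; exact h1.trans hsk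
      _ = (s * ‖ℓ‖) * s := by ring
      _ ≤ 1 / 2 * s := by gcongr
      _ = _ := by ring
  rw [abs_le] at hℓn
  refine ⟨h1, by linarith, by linarith, ?_⟩
  have hnorm : ‖Φ^[n] z‖ ≤ (n + 1) * M + 1 := by
    have : Φ^[n] z = (Φ^[n] z - (L ^ n) z) + (L ^ n) z := by abel
    rw [this]
    refine (norm_add_le _ _).trans ?_
    have h5 : ‖(L ^ n) z‖ ≤ (n + 1) * M :=
      ((L ^ n).le_opNorm _).trans (mul_le_mul (hL n) hz (norm_nonneg _) (by positivity))
    have h6 : s ^ 2 ≤ 1 := pow_le_one₀ hs.le hs1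
    linarith
  have h7 : ‖Φ^[n] z‖ * s ^ 4 ≤ 2 * M + 1 := by
    have h8 : s ^ 4 ≤ 1 := pow_le_one₀ hs.le hs1
    calc _ ≤ ((n + 1) * M + 1) * s ^ 4 := by gcongr
      _ = (n * s ^ 4) * M + s ^ 4 * M + s ^ 4 := by ring
      _ ≤ 1 * M + 1 * M + 1 := by gcongr
      _ = _ := by ring
  calc ‖Φ^[n] z‖ * ℓ (Φ^[n] z) ^ 5 ≤ ‖Φ^[n] z‖ * (2 * s) ^ 5 := by
        gcongr
        · linarith
        · linarith
    _ = 32 * (‖Φ^[n] z‖ * s ^ 4) * s := by ring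
    _ ≤ 32 * (2 * M + 1) * s := by gcongr
    _ ≤ 1 := hsM

end Orbits

/-! ### Sums along orbits and their smoothness up to the boundary -/

section OrbitSum

variable {E : Type} [NormedAddCommGroup E] [NormedSpace ℝ E]

/-- The data of a sum `∑ g ∘ Φ ^ n` along the orbits of `Φ = L + R`, in the form that passes to the
tangent map: `L` is unipotent and preserves `ℓ`, the perturbation `R` and the function `g` are flat
on `ℓ = 0`, and the orbit of `z` leaves the support of `g` after at most `ℓ(z) ^ (-3)` steps. -/
structure IsShearSystem (ℓ : E →L[ℝ] ℝ) (L : E →L[ℝ] E) (R : E → E) (g : E → ℝ) : Prop where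
  inv : ∀ z, ℓ (L z) = ℓ z
  growth : ∀ n : ℕ, ‖L ^ n‖ ≤ n + 1
  flat : TameFlat ℓ R
  flat_fun : TameFlat ℓ g
  exit : ∀ M : ℝ, ∃ δ > 0, ∀ z, ‖z‖ < M → 0 < ℓ z → ℓ z < δ → ∀ n : ℕ, 1 < n * ℓ z ^ 3 →
    g ((fun y => L y + R y)^[n] z) = 0

/-- The solution `-∑ g ∘ Φ ^ n` of `v ∘ Φ - v = g` on `ℓ > 0`, extended by zero. -/
noncomputable def orbitSum (ℓ : E →L[ℝ] ℝ) (Φ : E → E) (g : E → ℝ) (z : E) : ℝ :=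
  if 0 < ℓ z then -∑' n, g (Φ^[n] z) else 0

/-- The perturbation part of the tangent map `(z, w) ↦ (Φ(z), DΦ(z) w)`. -/
noncomputable def tangentPart (R : E → E) (p : E × E) : E × E := (R p.1, fderiv ℝ R p.1 p.2)

theorem IsShearSystem.contDiff_map {ℓ : E →L[ℝ] ℝ} {L : E →L[ℝ] E} {R : E → E} {g : E → ℝ}
    (h : IsShearSystem ℓ L R g) : ContDiff ℝ ∞ (fun y => L y + R y) :=
  L.contDiff.add h.flat.smooth

theorem contDiff_iterate {Φ : E → E} (h : ContDiff ℝ ∞ Φ) (n : ℕ) : ContDiff ℝ ∞ (Φ^[n]) := by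
  induction n with
  | zero => exact contDiff_id
  | succ n ih => rw [Function.iterate_succ']; exact h.comp ih

theorem iterate_tangent {ℓ : E →L[ℝ] ℝ} {L : E →L[ℝ] E} {R : E → E} {g : E → ℝ}
    (h : IsShearSystem ℓ L R g) (n : ℕ) (p : E × E) :
    (fun y => (L.prodMap L) y + tangentPart R y)^[n] p =
      ((fun y => L y + R y)^[n] p.1, fderiv ℝ ((fun y => L y + R y)^[n]) p.1 p.2) := by
  induction n with
  | zero => simp
  | succ n ih =>
    rw [Function.iterate_succ_apply', ih]
    have hd : Differentiable ℝ ((fun y => L y + R y)^[n]) :=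
      (contDiff_iterate h.contDiff_map n).differentiable (by simp)
    have hR : Differentiable ℝ R := h.flat.smooth.differentiable (by simp)
    have hΦ : Differentiable ℝ (fun y => L y + R y) := h.contDiff_map.differentiable (by simp)
    rw [Function.iterate_succ', fderiv_comp _ (hΦ _) (hd _),
      fderiv_fun_add L.differentiableAt (hR _)]
    simp [tangentPart]

/-- Nearby points have orbits that leave the support of `g` within a common number of steps. -/
theorem IsShearSystem.exists_eventually_zero {ℓ : E →L[ℝ] ℝ} {L : E →L[ℝ] E} {R : E → E} {g : E → ℝ}
    (h : IsShearSystem ℓ L R g) (M : ℝ) : ∃ δ > 0, ∀ z, ‖z‖ < M → 0 < ℓ z → ℓ z < δ →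
      (∀ n : ℕ, 1 < n * ℓ z ^ 3 → ∀ᶠ y in 𝓝 z, g ((fun y => L y + R y)^[n] y) = 0) ∧
      ∃ N : ℕ, ∀ᶠ y in 𝓝 z, 0 < ℓ y ∧ ∀ n, N ≤ n → g ((fun y => L y + R y)^[n] y) = 0 := by
  obtain ⟨δ, hδ, hex⟩ := h.exit M
  have hℓ : Continuous ℓ := ℓ.continuous
  refine ⟨δ, hδ, fun z hz h0 h1 => ?_⟩
  have e1 : ∀ᶠ y in 𝓝 z, ‖y‖ < M := continuous_norm.continuousAt.eventually_lt_const hz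
  have e2 : ∀ᶠ y in 𝓝 z, 0 < ℓ y := hℓ.continuousAt.eventually_const_lt h0
  have e3 : ∀ᶠ y in 𝓝 z, ℓ y < δ := hℓ.continuousAt.eventually_lt_const h1
  have e4 : ∀ n : ℕ, 1 < n * ℓ z ^ 3 → ∀ᶠ y in 𝓝 z, 1 < n * ℓ y ^ 3 := fun n hn =>
    (show ContinuousAt (fun y => (n : ℝ) * ℓ y ^ 3) z by fun_prop).eventually_const_lt hn
  constructor
  · intro n hn
    filter_upwards [e1, e2, e3, e4 n hn] with y h1 h2 h3 h4 using hex y h1 h2 h3 n h4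
  · obtain ⟨N, hN⟩ := exists_nat_gt (1 / ℓ z ^ 3)
    have hN' : 1 < N * ℓ z ^ 3 := by rwa [div_lt_iff₀ (by positivity)] at hN
    refine ⟨N, ?_⟩
    filter_upwards [e1, e2, e3, e4 N hN'] with y h1 h2 h3 h4
    refine ⟨h2, fun n hn => hex y h1 h2 h3 n (h4.trans_le ?_)⟩
    gcongr

theorem orbitSum_eq_sum {ℓ : E →L[ℝ] ℝ} {Φ : E → E} {g : E → ℝ} {z : E} (hz : 0 < ℓ z) {N : ℕ}
    (h : ∀ n, N ≤ n → g (Φ^[n] z) = 0) :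
    orbitSum ℓ Φ g z = -∑ n ∈ Finset.range N, g (Φ^[n] z) := by
  rw [orbitSum, if_pos hz, tsum_eq_sum]
  intro n hn
  exact h n (by simpa using hn)

/-- The class of shear systems is stable under passing to the tangent map. -/
theorem IsShearSystem.tangent {ℓ : E →L[ℝ] ℝ} {L : E →L[ℝ] E} {R : E → E} {g : E → ℝ}
    (h : IsShearSystem ℓ L R g) :
    IsShearSystem (ℓ.comp (ContinuousLinearMap.fst ℝ E E)) (L.prodMap L) (tangentPart R)
      (fun p => fderiv ℝ g p.1 p.2) := by
  refine ⟨fun z => h.inv z.1, fun n => ?_, h.flat.comp_fst.prodMk h.flat.fderiv_apply,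
    h.flat_fun.fderiv_apply, fun M => ?_⟩
  · have e : ∀ p, ((L.prodMap L) ^ n) p = ((L ^ n) p.1, (L ^ n) p.2) := by
      intro p
      induction n with
      | zero => simp
      | succ n ih => simp [pow_succ', mul_apply_eq_comp, ih]
    refine ContinuousLinearMap.opNorm_le_bound _ (by positivity) fun p => ?_
    rw [e, Prod.norm_def, Prod.norm_def]
    refine max_le (((L ^ n).le_opNorm _).trans ?_) (((L ^ n).le_opNorm _).trans ?_)
    · exact mul_le_mul (h.growth n) (le_max_left _ _) (norm_nonneg _) (by positivity)
    · exact mul_le_mul (h.growth n) (le_max_right _ _) (norm_nonneg _) (by positivity)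
  · obtain ⟨δ, hδ, hex⟩ := h.exists_eventually_zero M
    refine ⟨δ, hδ, fun p hp h0 h1 n hn => ?_⟩
    have hz := (hex p.1 ((norm_fst_le p).trans_lt hp) h0 h1).1 n hn
    rw [iterate_tangent h]
    have hd : Differentiable ℝ ((fun y => L y + R y)^[n]) :=
      (contDiff_iterate h.contDiff_map n).differentiable (by simp)
    have hg : Differentiable ℝ g := h.flat_fun.smooth.differentiable (by simp)
    have e := fderiv_comp p.1 (hg ((fun y => L y + R y)^[n] p.1)) (hd p.1)
    have e' : fderiv ℝ (g ∘ (fun y => L y + R y)^[n]) p.1 = 0 := by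
      have : (g ∘ (fun y => L y + R y)^[n]) =ᶠ[𝓝 p.1] fun _ => 0 := hz
      rw [this.fderiv_eq]; simp
    rw [e'] at e
    exact (congrArg (fun A : E →L[ℝ] ℝ => A p.2) e).symm

/-- Near `ℓ = 0` the orbit sum is flat: it has few terms, each of them tiny. -/
theorem IsShearSystem.abs_orbitSum_le {ℓ : E →L[ℝ] ℝ} {L : E →L[ℝ] E} {R : E → E} {g : E → ℝ}
    (h : IsShearSystem ℓ L R g) (M : ℝ) : ∃ δ > 0, ∀ z, ‖z‖ < M → 0 < ℓ z → ℓ z < δ →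
      |orbitSum ℓ (fun y => L y + R y) g z| ≤ ℓ z ^ 2 := by
  obtain ⟨δ₁, hδ₁, -, hsh⟩ := h.flat.exists_shadowing h.inv h.growth (max M 0) (le_max_right _ _) 0
  obtain ⟨δ₂, hδ₂, hex⟩ := h.exit M
  obtain ⟨C, hC0, hC⟩ := h.flat_fun.bound_nonneg 0 5 7
  have hC' : 0 < 1 / (2 + C * 2 ^ 7) := by positivity
  refine ⟨min (min δ₁ δ₂) (1 / (2 + C * 2 ^ 7)), by positivity, fun z hz h0 h1 => ?_⟩
  simp only [lt_min_iff] at h1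
  obtain ⟨⟨h11, h12⟩, h13⟩ := h1
  set s := ℓ z with hs
  have hsC : s * (2 + C * 2 ^ 7) < 1 := by rwa [lt_div_iff₀ (by positivity)] at h13
  have hs2 : s ≤ 1 / 2 := by nlinarith [mul_nonneg h0.le hC0]
  have hsC' : C * 2 ^ 7 * s ≤ 1 := by nlinarith
  set N := ⌊1 / s ^ 3⌋₊ + 1 with hN
  have hN1 : 1 < N * s ^ 3 := by
    have := Nat.lt_floor_add_one (1 / s ^ 3)
    rw [div_lt_iff₀ (by positivity)] at this
    exact_mod_cast this
  have hs3 : s ^ 3 ≤ 1 := pow_le_one₀ h0.le (by linarith)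
  have hN2 : (N : ℝ) * s ^ 4 ≤ 1 := by
    have := Nat.floor_le (a := 1 / s ^ 3) (by positivity)
    rw [le_div_iff₀ (by positivity)] at this
    calc (N : ℝ) * s ^ 4 = (⌊1 / s ^ 3⌋₊ * s ^ 3 + s ^ 3) * s := by rw [hN]; push_cast; ring
      _ ≤ (1 + 1) * (1 / 2) := by gcongr
      _ = 1 := by norm_num
  rw [orbitSum_eq_sum h0 (N := N), abs_neg]
  swap
  · intro n hn
    refine hex z hz h0 h12 n (hN1.trans_le ?_)
    gcongr
  refine (Finset.abs_sum_le_sum_abs _ _).trans ?_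
  calc _ ≤ ∑ n ∈ Finset.range N, C * (2 * s) ^ 7 := by
        refine Finset.sum_le_sum fun n hn => ?_
        have hnN : (n : ℝ) ≤ N := by exact_mod_cast (Finset.mem_range.mp hn).le
        obtain ⟨-, h2, h3, h4⟩ := hsh z (hz.le.trans (le_max_left _ _)) h0 h11 n
          (le_trans (by gcongr) hN2)
        have := hC _ (by linarith) (by linarith) h4
        rw [norm_iteratedFDeriv_zero, Real.norm_eq_abs] at this
        refine this.trans ?_
        gcongr
        linarith
    _ = (N * s ^ 4) * (C * 2 ^ 7 * s) * s ^ 2 := by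
        rw [Finset.sum_const, Finset.card_range, nsmul_eq_mul]; ring
    _ ≤ 1 * 1 * s ^ 2 := by gcongr
    _ = _ := by ring

/-- The orbit sum is smooth off the boundary, and its differential is the orbit sum of the tangent
system. -/
theorem IsShearSystem.orbitSum_interior {ℓ : E →L[ℝ] ℝ} {L : E →L[ℝ] E} {R : E → E} {g : E → ℝ}
    (h : IsShearSystem ℓ L R g) (M : ℝ) : ∃ δ > 0, ∀ z, ‖z‖ < M → 0 < ℓ z → ℓ z < δ →
      ContDiffAt ℝ ∞ (orbitSum ℓ (fun y => L y + R y) g) z ∧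
      ∀ w, fderiv ℝ (orbitSum ℓ (fun y => L y + R y) g) z w =
        orbitSum (ℓ.comp (ContinuousLinearMap.fst ℝ E E))
          (fun y => (L.prodMap L) y + tangentPart R y) (fun p => fderiv ℝ g p.1 p.2) (z, w) := by
  obtain ⟨δ, hδ, hex⟩ := h.exists_eventually_zero M
  refine ⟨δ, hδ, fun z hz h0 h1 => ?_⟩
  obtain ⟨-, N, hN⟩ := hex z hz h0 h1
  set Φ : E → E := fun y => L y + R y with hΦ
  have heq : orbitSum ℓ Φ g =ᶠ[𝓝 z] fun y => -∑ n ∈ Finset.range N, g (Φ^[n] y) := by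
    filter_upwards [hN] with y hy using orbitSum_eq_sum hy.1 hy.2
  have hgΦ : ∀ n, ContDiff ℝ ∞ (fun y => g (Φ^[n] y)) := fun n =>
    h.flat_fun.smooth.comp (contDiff_iterate h.contDiff_map n)
  refine ⟨ContDiffAt.congr_of_eventuallyEq
    (ContDiff.contDiffAt (ContDiff.neg (ContDiff.sum fun n _ => hgΦ n))) heq, fun w => ?_⟩
  have hD : ∀ n, fderiv ℝ (fun y => g (Φ^[n] y)) z w =
      (fun p : E × E => fderiv ℝ g p.1 p.2)
        ((fun y => (L.prodMap L) y + tangentPart R y)^[n] (z, w)) := by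
    intro n
    rw [iterate_tangent h]
    have hd : Differentiable ℝ (Φ^[n]) :=
      (contDiff_iterate h.contDiff_map n).differentiable (by simp)
    have hg : Differentiable ℝ g := h.flat_fun.smooth.differentiable (by simp)
    have e := fderiv_comp z (hg (Φ^[n] z)) (hd z)
    exact congrArg (fun A : E →L[ℝ] ℝ => A w) e
  rw [heq.fderiv_eq, orbitSum_eq_sum (N := N)]
  · rw [fderiv_fun_neg, fderiv_fun_sum fun n _ => ((hgΦ n).differentiable (by simp)) z]
    simp only [neg_apply, sum_apply]
    rw [Finset.sum_congr rfl fun n _ => hD n]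
  · exact h0
  · intro n hn
    refine (hD n).symm.trans ?_
    have : (fun y => g (Φ^[n] y)) =ᶠ[𝓝 z] fun _ => 0 := by
      filter_upwards [hN] with y hy using hy.2 n hn
    rw [this.fderiv_eq]; simp

theorem orbitSum_of_nonpos {ℓ : E →L[ℝ] ℝ} {Φ : E → E} {g : E → ℝ} {z : E} (hz : ℓ z ≤ 0) :
    orbitSum ℓ Φ g z = 0 := if_neg (not_lt.mpr hz)

/-- At the points of `ℓ = 0` the orbit sum has derivative zero. -/
theorem IsShearSystem.hasFDerivAt_boundary {ℓ : E →L[ℝ] ℝ} {L : E →L[ℝ] E} {R : E → E} {g : E → ℝ}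
    (h : IsShearSystem ℓ L R g) {z : E} (hz : ℓ z = 0) :
    HasFDerivAt (orbitSum ℓ (fun y => L y + R y) g) (0 : E →L[ℝ] ℝ) z := by
  obtain ⟨δ, hδ, hb⟩ := h.abs_orbitSum_le (‖z‖ + 1)
  have hO : orbitSum ℓ (fun y => L y + R y) g =O[𝓝 z] fun y => ‖y - z‖ ^ 2 := by
    refine Asymptotics.IsBigO.of_bound (‖ℓ‖ ^ 2) ?_
    have e1 : ∀ᶠ y in 𝓝 z, ‖y‖ < ‖z‖ + 1 :=
      continuous_norm.continuousAt.eventually_lt_const (by linarith)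
    have e3 : ∀ᶠ y in 𝓝 z, ℓ y < δ := ℓ.continuous.continuousAt.eventually_lt_const (by rwa [hz])
    filter_upwards [e1, e3] with y h1 h3
    rw [norm_pow, norm_norm, Real.norm_eq_abs]
    by_cases h0 : 0 < ℓ y
    · refine (hb y h1 h0 h3).trans ?_
      rw [← mul_pow]
      refine pow_le_pow_left₀ h0.le ?_ 2
      have : ℓ y = ℓ (y - z) := by rw [map_sub, hz, sub_zero]
      rw [this]
      exact (le_abs_self _).trans (ℓ.le_opNorm _)
    · rw [orbitSum_of_nonpos (not_lt.mp h0), abs_zero]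
      positivity
  exact hO.hasFDerivAt (by norm_num)

theorem orbitSum_eventuallyEq_zero {ℓ : E →L[ℝ] ℝ} {Φ : E → E} {g : E → ℝ} {z : E} (hz : ℓ z < 0) :
    orbitSum ℓ Φ g =ᶠ[𝓝 z] fun _ => 0 := by
  filter_upwards [ℓ.continuous.continuousAt.eventually_lt_const hz] with y hy
  exact orbitSum_of_nonpos (le_of_lt hy)

theorem contDiffAt_clm_of_apply {F : Type} [NormedAddCommGroup F] [NormedSpace ℝ F]
    [FiniteDimensional ℝ E] {n : ℕ∞ω} {f : F → E →L[ℝ] ℝ} {x : F}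
    (h : ∀ w, ContDiffAt ℝ n (fun y => f y w) x) : ContDiffAt ℝ n f x := by
  let d := Module.finrank ℝ E
  have hd : d = Module.finrank ℝ (Fin d → ℝ) := (Module.finrank_fin_fun ℝ).symm
  let e₁ := ContinuousLinearEquiv.ofFinrankEq hd
  let e₂ := (e₁.arrowCongr (1 : ℝ ≃L[ℝ] ℝ)).trans (ContinuousLinearEquiv.piRing (Fin d))
  rw [← Function.id_comp f, ← e₂.symm_comp_self]
  exact e₂.symm.contDiff.contDiffAt.comp x (contDiffAt_pi.mpr fun i => h _)

end OrbitSum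

/-- The orbit sum is smooth at the boundary points. The induction on the order of differentiability
runs over all shear systems at once: the differential of the orbit sum of a system is the orbit sum
of its tangent system. -/
theorem IsShearSystem.contDiffAt_boundary (k : ℕ) :
    ∀ {E : Type} [NormedAddCommGroup E] [NormedSpace ℝ E] [FiniteDimensional ℝ E]
      {ℓ : E →L[ℝ] ℝ} {L : E →L[ℝ] E} {R : E → E} {g : E → ℝ}, IsShearSystem ℓ L R g →
      ∀ z, ℓ z = 0 → ContDiffAt ℝ k (orbitSum ℓ (fun y => L y + R y) g) z := by
  induction k with
  | zero =>
    intro E _ _ _ ℓ L R g h z hz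
    obtain ⟨δ, hδ, hint⟩ := h.orbitSum_interior (‖z‖ + 1)
    have e1 : ∀ᶠ y in 𝓝 z, ‖y‖ < ‖z‖ + 1 :=
      continuous_norm.continuousAt.eventually_lt_const (by linarith)
    have e3 : ∀ᶠ y in 𝓝 z, ℓ y < δ := ℓ.continuous.continuousAt.eventually_lt_const (by rwa [hz])
    refine contDiffAt_zero.mpr ⟨_, e1.and e3, fun y hy => ContinuousAt.continuousWithinAt ?_⟩
    rcases lt_trichotomy (ℓ y) 0 with h0 | h0 | h0
    · exact (continuousAt_const).congr (orbitSum_eventuallyEq_zero h0).symm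
    · exact (h.hasFDerivAt_boundary h0).continuousAt
    · exact (hint y hy.1 h0 hy.2).1.continuousAt
  | succ k ih =>
    intro E _ _ _ ℓ L R g h z hz
    obtain ⟨δ, hδ, hint⟩ := h.orbitSum_interior (‖z‖ + 1)
    have e1 : ∀ᶠ y in 𝓝 z, ‖y‖ < ‖z‖ + 1 :=
      continuous_norm.continuousAt.eventually_lt_const (by linarith)
    have e3 : ∀ᶠ y in 𝓝 z, ℓ y < δ := ℓ.continuous.continuousAt.eventually_lt_const (by rwa [hz])
    set v := orbitSum ℓ (fun y => L y + R y) g with hv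
    have hD : ∀ᶠ y in 𝓝 z, DifferentiableAt ℝ v y ∧ ∀ w, fderiv ℝ v y w =
        orbitSum (ℓ.comp (ContinuousLinearMap.fst ℝ E E))
          (fun y => (L.prodMap L) y + tangentPart R y) (fun p => fderiv ℝ g p.1 p.2) (y, w) := by
      filter_upwards [e1, e3] with y h1 h3
      rcases lt_trichotomy (ℓ y) 0 with h0 | h0 | h0
      · have e := orbitSum_eventuallyEq_zero (Φ := fun y => L y + R y) (g := g) h0
        refine ⟨(differentiableAt_const _).congr_of_eventuallyEq e, fun w => ?_⟩
        rw [e.fderiv_eq, orbitSum_of_nonpos (by exact h0.le)]; simp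
      · refine ⟨(h.hasFDerivAt_boundary h0).differentiableAt, fun w => ?_⟩
        rw [(h.hasFDerivAt_boundary h0).fderiv, orbitSum_of_nonpos (by exact h0.le)]; simp
      · exact ⟨(hint y h1 h0 h3).1.differentiableAt (by simp), (hint y h1 h0 h3).2⟩
    push_cast
    refine contDiffAt_succ_iff_hasFDerivAt.mpr ⟨fderiv ℝ v, ⟨_, hD, fun y hy => hy.1.hasFDerivAt⟩, ?_⟩
    refine contDiffAt_clm_of_apply fun w => ?_
    have hw := (ih h.tangent (z, w) hz).comp z
      (contDiffAt_id.prodMk contDiffAt_const : ContDiffAt ℝ k (fun y : E => (y, w)) z)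
    refine hw.congr_of_eventuallyEq ?_
    filter_upwards [hD] with y hy using hy.2 w

/-! ### Flat functions as germs of smooth functions on the plane -/

/-- `u` vanishes on the closed half-plane `φ ≤ 0` and is smooth on a neighbourhood in the plane of
every boundary point. Up to extension by zero these are exactly the `φ`-flat functions. -/
structure FlatGerm (I : Set ℝ) (u : ℝ × ℝ → ℝ) : Prop where
  zero : ∀ x : ℝ × ℝ, x.2 ≤ 0 → u x = 0
  smooth : ∀ t ∈ I, ∀ᶠ x in 𝓝 ((t, 0) : ℝ × ℝ), ContDiffAt ℝ ∞ u x

/-- The extension by zero of a function from the half-plane `φ > 0` to the plane. -/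
noncomputable def zeroExt {G : Type} [Zero G] (f : ℝ × ℝ → G) (x : ℝ × ℝ) : G :=
  if 0 < x.2 then f x else 0

theorem zeroExt_of_pos {G : Type} [Zero G] {f : ℝ × ℝ → G} {x : ℝ × ℝ} (h : 0 < x.2) :
    zeroExt f x = f x := if_pos h

theorem zeroExt_of_nonpos {G : Type} [Zero G] {f : ℝ × ℝ → G} {x : ℝ × ℝ} (h : x.2 ≤ 0) :
    zeroExt f x = 0 := if_neg (not_lt.mpr h)

theorem zeroExt_eventuallyEq {G : Type} [Zero G] (f : ℝ × ℝ → G) {x : ℝ × ℝ} (h : 0 < x.2) :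
    zeroExt f =ᶠ[𝓝 x] f := by
  filter_upwards [continuous_snd.continuousAt.eventually_const_lt h] with y hy
  exact zeroExt_of_pos hy

theorem zeroExt_eventuallyEq_zero {G : Type} [Zero G] (f : ℝ × ℝ → G) {x : ℝ × ℝ} (h : x.2 < 0) :
    zeroExt f =ᶠ[𝓝 x] fun _ => 0 := by
  filter_upwards [continuous_snd.continuousAt.eventually_lt_const h] with y hy
  exact zeroExt_of_nonpos (le_of_lt hy)

theorem IsAdjacentDomain.eventually_mem {I : Set ℝ} {W : Set (ℝ × ℝ)} (hW : IsAdjacentDomain I W)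
    {t : ℝ} (ht : t ∈ I) : ∀ᶠ x in 𝓝 ((t, 0) : ℝ × ℝ), 0 < x.2 → x ∈ W := by
  have := hW.adjacent t ht
  exact mem_nhdsWithin_iff_eventually.mp this

/-- A uniform neighbourhood of `J` is obtained on compact subsets of `I`. -/
theorem exists_forall_of_eventually {p : ℝ × ℝ → Prop} {K : Set ℝ} (hK : IsCompact K)
    (h : ∀ t ∈ K, ∀ᶠ x in 𝓝 ((t, 0) : ℝ × ℝ), p x) :
    ∃ δ > 0, ∀ s ∈ K, ∀ y : ℝ, |y| < δ → p (s, y) := by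
  obtain ⟨u, v, -, hv, hKu, h0v, huv⟩ := generalized_tube_lemma hK (isCompact_singleton (x := (0 : ℝ)))
    (isOpen_setOfPred_eventually_nhds (p := p)) (by
      rintro ⟨s, y⟩ ⟨hs, hy⟩
      obtain rfl : y = 0 := hy
      exact h s hs)
  obtain ⟨δ, hδ, hb⟩ := Metric.isOpen_iff.mp hv 0 (h0v rfl)
  refine ⟨δ, hδ, fun s hs y hy => ?_⟩
  have : (s, y) ∈ u ×ˢ v := ⟨hKu hs, hb (by simpa [Real.dist_eq] using hy)⟩
  exact (huv this).self_of_nhds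

/-- If a function is smooth on `W` and all its derivatives tend to zero at a boundary point, then
its extension by zero is smooth there. The induction on the order passes to the derivative. -/
theorem contDiffAt_zeroExt (k : ℕ) : ∀ {G : Type} [NormedAddCommGroup G] [NormedSpace ℝ G]
    {f : ℝ × ℝ → G} {I : Set ℝ} {W : Set (ℝ × ℝ)}, IsOpen I → IsAdjacentDomain I W →
    (∀ x ∈ W, ContDiffAt ℝ ∞ f x) →
    (∀ n : ℕ, ∀ t ∈ I, ∀ ε > 0, ∀ᶠ x in 𝓝 ((t, 0) : ℝ × ℝ), 0 < x.2 →
      ‖iteratedFDeriv ℝ n f x‖ < ε) →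
    ∀ t ∈ I, ContDiffAt ℝ k (zeroExt f) (t, 0) := by
  -- the extension is continuous and differentiable near the boundary point
  have hcont : ∀ {G : Type} [NormedAddCommGroup G] [NormedSpace ℝ G]
      {f : ℝ × ℝ → G} {I : Set ℝ},
      (∀ n : ℕ, ∀ t ∈ I, ∀ ε > 0, ∀ᶠ x in 𝓝 ((t, 0) : ℝ × ℝ), 0 < x.2 →
        ‖iteratedFDeriv ℝ n f x‖ < ε) → ∀ t ∈ I, ContinuousAt (zeroExt f) (t, 0) := by
    intro G _ _ f I hd t ht
    rw [Metric.continuousAt_iff']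
    intro ε hε
    filter_upwards [hd 0 t ht ε hε] with x hx
    rw [zeroExt_of_nonpos (x := (t, 0)) le_rfl, dist_zero_right]
    by_cases h0 : 0 < x.2
    · rw [zeroExt_of_pos h0]; simpa using hx h0
    · rw [zeroExt_of_nonpos (not_lt.mp h0)]; simpa using hε
  have hev : ∀ {I : Set ℝ} {W : Set (ℝ × ℝ)}, IsOpen I → IsAdjacentDomain I W → ∀ t ∈ I,
      ∀ᶠ x in 𝓝 ((t, 0) : ℝ × ℝ), x.1 ∈ I ∧ (0 < x.2 → x ∈ W) := fun hI hW t ht =>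
    (continuous_fst.continuousAt.eventually_mem (hI.mem_nhds ht)).and (hW.eventually_mem ht)
  have hderiv : ∀ {G : Type} [NormedAddCommGroup G] [NormedSpace ℝ G]
      {f : ℝ × ℝ → G} {I : Set ℝ} {W : Set (ℝ × ℝ)}, IsOpen I → IsAdjacentDomain I W →
      (∀ x ∈ W, ContDiffAt ℝ ∞ f x) →
      (∀ n : ℕ, ∀ t ∈ I, ∀ ε > 0, ∀ᶠ x in 𝓝 ((t, 0) : ℝ × ℝ), 0 < x.2 →
        ‖iteratedFDeriv ℝ n f x‖ < ε) → ∀ t ∈ I,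
      HasFDerivAt (zeroExt f) (0 : ℝ × ℝ →L[ℝ] G) (t, 0) := by
    intro G _ _ f I W hI hW hs hd t ht
    obtain ⟨r, hr, hball⟩ := Metric.eventually_nhds_iff_ball.mp (hev hI hW t ht)
    set s : Set (ℝ × ℝ) := Metric.ball (t, 0) r ∩ {x | 0 < x.2} with hsdef
    have hso : IsOpen s := Metric.isOpen_ball.inter (isOpen_lt continuous_const continuous_snd)
    have hsW : s ⊆ W := fun x hx => (hball x hx.1).2 hx.2
    have hhalf : Convex ℝ {x : ℝ × ℝ | 0 < x.2} :=
      (convex_Ioi (0 : ℝ)).linear_preimage (LinearMap.snd ℝ ℝ ℝ)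
    -- a smaller ball, on whose closure everything is still controlled
    set s' : Set (ℝ × ℝ) := Metric.ball (t, 0) (r / 2) ∩ {x | 0 < x.2} with hs'def
    have hs'o : IsOpen s' := Metric.isOpen_ball.inter (isOpen_lt continuous_const continuous_snd)
    have hcl : ∀ y ∈ closure s', y ∈ Metric.ball ((t, 0) : ℝ × ℝ) r ∧ 0 ≤ y.2 := by
      intro y hy
      have h1 : y ∈ Metric.closedBall ((t, 0) : ℝ × ℝ) (r / 2) :=
        closure_minimal (inter_subset_left.trans Metric.ball_subset_closedBall)
          Metric.isClosed_closedBall hy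
      refine ⟨Metric.closedBall_subset_ball (by linarith) h1, ?_⟩
      exact closure_minimal (s := s') (t := {x : ℝ × ℝ | 0 ≤ x.2})
        (fun x hx => show (0 : ℝ) ≤ x.2 from le_of_lt hx.2) (isClosed_le continuous_const continuous_snd) hy
    have key : HasFDerivWithinAt (zeroExt f) (0 : ℝ × ℝ →L[ℝ] G) (closure s') (t, 0) := by
      refine hasFDerivWithinAt_closure_of_tendsto_fderiv ?_ ((convex_ball _ _).inter hhalf) hs'o ?_ ?_
      · intro x hx
        have hxs : x ∈ s := ⟨Metric.ball_subset_ball (by linarith) hx.1, hx.2⟩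
        exact (((hs x (hsW hxs)).differentiableAt (by simp)).congr_of_eventuallyEq
          (zeroExt_eventuallyEq f hx.2)).differentiableWithinAt
      · intro y hy
        obtain ⟨h1, h2⟩ := hcl y hy
        refine ContinuousAt.continuousWithinAt ?_
        rcases h2.lt_or_eq with h0 | h0
        · exact ((hs y ((hball y h1).2 h0)).continuousAt).congr (zeroExt_eventuallyEq f h0).symm
        · have : y = (y.1, 0) := Prod.ext rfl h0.symm
          rw [this]
          exact hcont hd y.1 (hball y h1).1
      · rw [Metric.tendsto_nhds]
        intro ε hε
        have h1 := (hd 1 t ht ε hε).filter_mono (nhdsWithin_le_nhds (s := s'))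
        filter_upwards [h1, self_mem_nhdsWithin] with x hx hxs
        rw [dist_zero_right, (zeroExt_eventuallyEq f hxs.2).fderiv_eq,
          ← norm_iteratedFDeriv_zero (𝕜 := ℝ) (f := fderiv ℝ f), norm_iteratedFDeriv_fderiv]
        exact hx hxs.2
    have hlow : HasFDerivWithinAt (zeroExt f) (0 : ℝ × ℝ →L[ℝ] G) {x | x.2 ≤ 0} (t, 0) :=
      (hasFDerivWithinAt_const (0 : G) _ _).congr (fun x hx => zeroExt_of_nonpos hx)
        (zeroExt_of_nonpos le_rfl)
    refine (key.union hlow).hasFDerivAt ?_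
    filter_upwards [Metric.ball_mem_nhds _ (half_pos hr)] with x hx
    by_cases h0 : 0 < x.2
    · exact Or.inl (subset_closure ⟨hx, h0⟩)
    · exact Or.inr (not_lt.mp h0)
  induction k with
  | zero =>
    intro G _ _ f I W hI hW hs hd t ht
    refine contDiffAt_zero.mpr ⟨_, hev hI hW t ht, fun y hy => ContinuousAt.continuousWithinAt ?_⟩
    rcases lt_trichotomy y.2 0 with h0 | h0 | h0
    · exact continuousAt_const.congr (zeroExt_eventuallyEq_zero f h0).symm
    · have : y = (y.1, 0) := Prod.ext rfl h0
      rw [this]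
      exact hcont hd _ hy.1
    · exact ((hs y (hy.2 h0)).continuousAt).congr (zeroExt_eventuallyEq f h0).symm
  | succ k ih =>
    intro G _ _ f I W hI hW hs hd t ht
    have hs' : ∀ x ∈ W, ContDiffAt ℝ ∞ (fderiv ℝ f) x := fun x hx =>
      (hs x hx).fderiv_right (by simp)
    have hd' : ∀ n : ℕ, ∀ t ∈ I, ∀ ε > 0, ∀ᶠ x in 𝓝 ((t, 0) : ℝ × ℝ), 0 < x.2 →
        ‖iteratedFDeriv ℝ n (fderiv ℝ f) x‖ < ε := by
      intro n t ht ε hε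
      simpa only [norm_iteratedFDeriv_fderiv] using hd (n + 1) t ht ε hε
    have := ih hI hW hs' hd' t ht
    push_cast
    refine contDiffAt_succ_iff_hasFDerivAt.mpr
      ⟨zeroExt (fderiv ℝ f), ⟨_, hev hI hW t ht, fun y hy => ?_⟩, this⟩
    rcases lt_trichotomy y.2 0 with h0 | h0 | h0
    · rw [zeroExt_of_nonpos h0.le]
      exact (hasFDerivAt_const _ _).congr_of_eventuallyEq (zeroExt_eventuallyEq_zero f h0)
    · have e : y = (y.1, 0) := Prod.ext rfl h0
      rw [e, zeroExt_of_nonpos le_rfl]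
      exact hderiv hI hW hs hd _ hy.1
    · rw [zeroExt_of_pos h0]
      exact ((hs y (hy.2 h0)).differentiableAt (by simp)).hasFDerivAt.congr_of_eventuallyEq
        (zeroExt_eventuallyEq f h0)

theorem IsFlat.contDiffAt {I : Set ℝ} {W : Set (ℝ × ℝ)} {f : ℝ × ℝ → ℝ} (hf : IsFlat I W f)
    (hW : IsAdjacentDomain I W) {x : ℝ × ℝ} (hx : x ∈ W) : ContDiffAt ℝ ∞ f x :=
  hf.smooth.contDiffAt (Filter.mem_of_superset (hW.isOpen.mem_nhds hx) subset_union_left)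

theorem IsFlat.flatGerm {I : Set ℝ} (hI : IsOpen I) {W : Set (ℝ × ℝ)} (hW : IsAdjacentDomain I W)
    {f : ℝ × ℝ → ℝ} (hf : IsFlat I W f) : FlatGerm I (zeroExt f) := by
  have hs : ∀ x ∈ W, ContDiffAt ℝ ∞ f x := fun x hx => hf.contDiffAt hW hx
  have hd : ∀ n : ℕ, ∀ t ∈ I, ∀ ε > 0, ∀ᶠ x in 𝓝 ((t, 0) : ℝ × ℝ), 0 < x.2 →
      ‖iteratedFDeriv ℝ n f x‖ < ε := by
    intro n t ht ε hε
    obtain ⟨r, hr, hK⟩ := Metric.nhds_basis_closedBall.mem_iff.mp (hI.mem_nhds ht)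
    obtain ⟨δ, hδ, hb⟩ := hf.decay n _ (isCompact_closedBall t r) hK ε hε
    have e1 : ∀ᶠ x in 𝓝 ((t, 0) : ℝ × ℝ), x.1 ∈ Metric.closedBall t r :=
      continuous_fst.continuousAt.eventually_mem (Metric.closedBall_mem_nhds t hr)
    have e2 : ∀ᶠ x in 𝓝 ((t, 0) : ℝ × ℝ), x.2 < δ :=
      continuous_snd.continuousAt.eventually_lt_const hδ
    filter_upwards [e1, e2, hW.eventually_mem ht] with x h1 h2 h3 h0
    exact hb x.1 h1 x.2 h0 h2 (h3 h0)
  refine ⟨fun x hx => zeroExt_of_nonpos hx, fun t ht => ?_⟩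
  have e1 : ∀ᶠ x in 𝓝 ((t, 0) : ℝ × ℝ), x.1 ∈ I :=
    continuous_fst.continuousAt.eventually_mem (hI.mem_nhds ht)
  filter_upwards [e1, hW.eventually_mem ht] with x h1 h2
  rcases lt_trichotomy x.2 0 with h0 | h0 | h0
  · exact contDiffAt_const.congr_of_eventuallyEq (zeroExt_eventuallyEq_zero f h0)
  · have e : x = (x.1, 0) := Prod.ext rfl h0
    rw [e]
    exact contDiffAt_infty.mpr fun k => contDiffAt_zeroExt k hI hW hs hd x.1 h1
  · exact (hs x (h2 h0)).congr_of_eventuallyEq (zeroExt_eventuallyEq f h0)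

theorem FlatGerm.iteratedFDeriv_eq_zero {I : Set ℝ} {u : ℝ × ℝ → ℝ} (hu : FlatGerm I u) (n : ℕ)
    {t : ℝ} (ht : t ∈ I) : iteratedFDeriv ℝ n u (t, 0) = 0 := by
  have hc : ContinuousAt (iteratedFDeriv ℝ n u) (t, 0) :=
    (hu.smooth t ht).self_of_nhds.continuousAt_iteratedFDeriv (by exact_mod_cast le_top)
  have hp : Filter.Tendsto (fun s : ℝ => ((t, s) : ℝ × ℝ)) (𝓝[<] 0) (𝓝 (t, 0)) :=
    ((Continuous.prodMk_right t).tendsto 0).mono_left nhdsWithin_le_nhds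
  refine tendsto_nhds_unique (hc.tendsto.comp hp) (tendsto_const_nhds.congr' ?_)
  filter_upwards [self_mem_nhdsWithin] with s hs
  have : u =ᶠ[𝓝 ((t, s) : ℝ × ℝ)] fun _ => 0 := by
    filter_upwards [continuous_snd.continuousAt.eventually_lt_const (mem_Iio.mp hs)] with y hy
    exact hu.zero y (le_of_lt hy)
  rw [Function.comp_apply, (this.iteratedFDeriv ℝ n).eq_of_nhds, iteratedFDeriv_fun_zero]
  rfl

theorem FlatGerm.contDiffOn {I : Set ℝ} {W : Set (ℝ × ℝ)} {u : ℝ × ℝ → ℝ} (hu : FlatGerm I u)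
    (hs : ∀ x ∈ W, ContDiffAt ℝ ∞ u x) : ContDiffOn ℝ ∞ u (W ∪ bdry I) := by
  rintro x (hx | hx)
  · exact (hs x hx).contDiffWithinAt
  · have e : x = (x.1, 0) := Prod.ext rfl hx.2
    rw [e]
    exact (hu.smooth _ hx.1).self_of_nhds.contDiffWithinAt

/-- A smooth function on the plane that vanishes for `φ ≤ 0` is `φ`-flat. -/
theorem FlatGerm.isFlat {I : Set ℝ} {W : Set (ℝ × ℝ)} (hW : IsAdjacentDomain I W)
    {u : ℝ × ℝ → ℝ} (hu : FlatGerm I u) (hs : ∀ x ∈ W, ContDiffAt ℝ ∞ u x) {f : ℝ × ℝ → ℝ}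
    (hf : ∀ x ∈ W ∪ bdry I, f x = u x) : IsFlat I W f := by
  refine ⟨(hu.contDiffOn hs).congr hf, fun x hx => ?_, fun n K hK hKI ε hε => ?_⟩
  · rw [hf x (Or.inr hx), hu.zero x hx.2.le]
  · have hev : ∀ t ∈ K, ∀ᶠ x in 𝓝 ((t, 0) : ℝ × ℝ), ‖iteratedFDeriv ℝ n u x‖ < ε := by
      intro t ht
      have hc : ContinuousAt (iteratedFDeriv ℝ n u) (t, 0) :=
        (hu.smooth t (hKI ht)).self_of_nhds.continuousAt_iteratedFDeriv (by exact_mod_cast le_top)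
      refine hc.norm.eventually_lt_const ?_
      simpa [hu.iteratedFDeriv_eq_zero n (hKI ht)] using hε
    obtain ⟨δ, hδ, hb⟩ := exists_forall_of_eventually hK hev
    refine ⟨δ, hδ, fun s hs y hy hyδ hW' => ?_⟩
    have : f =ᶠ[𝓝 (s, y)] u := by
      filter_upwards [hW.isOpen.mem_nhds hW'] with z hz using hf z (Or.inl hz)
    rw [(this.iteratedFDeriv ℝ n).eq_of_nhds]
    exact hb s hs y (by rwa [abs_of_pos hy])

/-! ### Adjacent domains -/

/-- Inside any set that contains a one-sided neighbourhood of each point of `J` there is a domain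
adjacent to `J`: a union of boxes standing on `J`. -/
theorem exists_isAdjacentDomain {I : Set ℝ} (hI : IsOpen I) (hIc : I.OrdConnected)
    (hIn : I.Nonempty) {p : ℝ × ℝ → Prop}
    (h : ∀ t ∈ I, ∀ᶠ x in 𝓝 ((t, 0) : ℝ × ℝ), 0 < x.2 → p x) :
    ∃ W, IsAdjacentDomain I W ∧ ∀ x ∈ W, x.1 ∈ I ∧ p x := by
  have hbox : ∀ t ∈ I, ∃ r > 0, ∀ x : ℝ × ℝ, dist x (t, 0) < r → x.1 ∈ I ∧ (0 < x.2 → p x) := by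
    intro t ht
    have e1 : ∀ᶠ x in 𝓝 ((t, 0) : ℝ × ℝ), x.1 ∈ I :=
      continuous_fst.continuousAt.eventually_mem (hI.mem_nhds ht)
    exact Metric.eventually_nhds_iff.mp (e1.and (h t ht))
  choose! r hr hp using hbox
  set W : Set (ℝ × ℝ) := {x | 0 < x.2 ∧ ∃ t ∈ I, dist x (t, 0) < r t} with hWdef
  have hmono : ∀ x ∈ W, ∀ y, 0 < y → y ≤ x.2 → (x.1, y) ∈ W := by
    rintro x ⟨hx0, t, ht, hx⟩ y hy hyx
    refine ⟨hy, t, ht, lt_of_le_of_lt ?_ hx⟩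
    rw [Prod.dist_eq, Prod.dist_eq]
    refine max_le_max le_rfl ?_
    simp only [dist_zero_right, Real.norm_eq_abs]
    rwa [abs_of_pos hy, abs_of_pos hx0]
  have hWI : ∀ x ∈ W, x.1 ∈ I ∧ p x := by
    rintro x ⟨hx0, t, ht, hx⟩
    exact ⟨(hp t ht x hx).1, (hp t ht x hx).2 hx0⟩
  have hadj : ∀ t ∈ I, ∀ᶠ x in 𝓝 ((t, 0) : ℝ × ℝ), 0 < x.2 → x ∈ W := by
    intro t ht
    filter_upwards [Metric.ball_mem_nhds _ (hr t ht)] with x hx h0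
    exact ⟨h0, t, ht, hx⟩
  have hvert : ∀ x ∈ W, ∀ y, 0 < y → y ≤ x.2 → ∃ s ⊆ W, x ∈ s ∧ (x.1, y) ∈ s ∧ IsPreconnected s := by
    intro x hx y hy hyx
    refine ⟨(fun s : ℝ => (x.1, s)) '' Icc y x.2, ?_, ⟨x.2, ⟨hyx, le_rfl⟩, rfl⟩,
      ⟨y, ⟨le_rfl, hyx⟩, rfl⟩, isPreconnected_Icc.image _ (by fun_prop)⟩
    rintro _ ⟨s, ⟨hs1, hs2⟩, rfl⟩
    exact hmono x hx s (hy.trans_le hs1) hs2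
  refine ⟨W, ⟨?_, ⟨?_, ?_⟩, fun x hx => hx.1, fun t ht => ?_⟩, hWI⟩
  · have : W = {x : ℝ × ℝ | 0 < x.2} ∩ ⋃ t ∈ I, Metric.ball (t, 0) (r t) := by
      ext x; simp [hWdef]
    rw [this]
    exact (isOpen_lt continuous_const continuous_snd).inter
      (isOpen_biUnion fun t _ => Metric.isOpen_ball)
  · obtain ⟨t, ht⟩ := hIn
    refine ⟨(t, r t / 2), half_pos (hr t ht), t, ht, ?_⟩
    have := hr t ht
    simp only [Prod.dist_eq, dist_self, dist_zero_right, Real.norm_eq_abs]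
    rw [abs_of_pos (by linarith), max_lt_iff]
    constructor <;> linarith
  · refine isPreconnected_of_forall_pair fun x hx y hy => ?_
    have hseg : uIcc x.1 y.1 ⊆ I := hIc.uIcc_subset (hWI x hx).1 (hWI y hy).1
    obtain ⟨δ, hδ, hb⟩ := exists_forall_of_eventually (isCompact_uIcc (a := x.1) (b := y.1))
      fun t ht => hadj t (hseg ht)
    set e := min (δ / 2) (min x.2 y.2) with he
    have hx0 : 0 < x.2 := hx.1
    have hy0 : 0 < y.2 := hy.1
    have he0 : 0 < e := by positivity
    have heδ : |e| < δ := by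
      rw [abs_of_pos he0]; exact (min_le_left _ _).trans_lt (by linarith)
    obtain ⟨s₁, h1, hx1, hx2, hc1⟩ := hvert x hx e he0
      ((min_le_right _ _).trans (min_le_left _ _))
    obtain ⟨s₂, h2, hy1, hy2, hc2⟩ := hvert y hy e he0
      ((min_le_right _ _).trans (min_le_right _ _))
    set m := (fun s : ℝ => (s, e)) '' uIcc x.1 y.1 with hm
    have hmc : IsPreconnected m := isPreconnected_uIcc.image _ (by fun_prop)
    have hmW : m ⊆ W := by
      rintro _ ⟨s, hs, rfl⟩
      exact hb s hs e heδ he0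
    refine ⟨(s₁ ∪ m) ∪ s₂, union_subset (union_subset h1 hmW) h2, Or.inl (Or.inl hx1), Or.inr hy1, ?_⟩
    refine IsPreconnected.union (y.1, e) (Or.inr ⟨y.1, right_mem_uIcc, rfl⟩) hy2 ?_ hc2
    exact IsPreconnected.union (x.1, e) hx2 ⟨x.1, left_mem_uIcc, rfl⟩ hc1 hmc
  · exact mem_nhdsWithin_iff_eventually.mpr (hadj t ht)

/-- `W ∪ J` has unique differentials, so that derivatives within it are the derivatives of any
smooth extension. -/
theorem IsAdjacentDomain.uniqueDiffWithinAt {I : Set ℝ} {W : Set (ℝ × ℝ)}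
    (hW : IsAdjacentDomain I W) {x : ℝ × ℝ} (hx : x ∈ W ∪ bdry I) :
    UniqueDiffWithinAt ℝ (W ∪ bdry I) x := by
  rcases hx with hx | hx
  · exact (hW.isOpen.uniqueDiffWithinAt hx).mono subset_union_left
  · have e : x = (x.1, 0) := Prod.ext rfl hx.2
    obtain ⟨r, hr, hb⟩ := Metric.eventually_nhds_iff_ball.mp (hW.eventually_mem hx.1)
    have hhalf : Convex ℝ {x : ℝ × ℝ | 0 < x.2} :=
      (convex_Ioi (0 : ℝ)).linear_preimage (LinearMap.snd ℝ ℝ ℝ)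
    set s : Set (ℝ × ℝ) := Metric.ball (x.1, 0) r ∩ {x | 0 < x.2} with hs
    have hso : IsOpen s := Metric.isOpen_ball.inter (isOpen_lt continuous_const continuous_snd)
    have hmem : ∀ y : ℝ, 0 < y → y < r → (x.1, y) ∈ s := by
      intro y hy hyr
      refine ⟨?_, hy⟩
      simp only [Metric.mem_ball, Prod.dist_eq, dist_self, dist_zero_right, Real.norm_eq_abs]
      rw [abs_of_pos hy, max_lt_iff]
      exact ⟨hr, hyr⟩
    have hcl : x ∈ closure s := by
      rw [e]
      have hp : Filter.Tendsto (fun s : ℝ => ((x.1, s) : ℝ × ℝ)) (𝓝[>] 0) (𝓝 (x.1, 0)) :=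
        ((Continuous.prodMk_right x.1).tendsto 0).mono_left nhdsWithin_le_nhds
      refine mem_closure_of_tendsto hp ?_
      filter_upwards [Ioo_mem_nhdsGT hr] with y hy using hmem y hy.1 hy.2
    refine (uniqueDiffWithinAt_convex ((convex_ball _ _).inter hhalf) ?_ hcl).mono ?_
    · rw [hso.interior_eq]
      exact ⟨_, hmem (r / 2) (by linarith) (by linarith)⟩
    · exact fun y hy => Or.inl (hb y hy.1 hy.2)

/-! ### Globalization of flat germs -/

/-- A smooth function on the plane with bounded derivatives of all orders that vanishes for
`φ ≤ 0`. -/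
structure GlobalFlat (u : ℝ × ℝ → ℝ) : Prop where
  smooth : ContDiff ℝ ∞ u
  zero : ∀ x : ℝ × ℝ, x.2 ≤ 0 → u x = 0
  bdd : ∀ n : ℕ, ∃ C : ℝ, ∀ x, ‖iteratedFDeriv ℝ n u x‖ ≤ C

theorem GlobalFlat.flatGerm {u : ℝ × ℝ → ℝ} (hu : GlobalFlat u) (I : Set ℝ) : FlatGerm I u :=
  ⟨hu.zero, fun _ _ => Filter.Eventually.of_forall fun _ => hu.smooth.contDiffAt⟩

theorem GlobalFlat.iteratedFDeriv_of_nonpos {u : ℝ × ℝ → ℝ} (hu : GlobalFlat u) (n : ℕ)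
    {x : ℝ × ℝ} (hx : x.2 ≤ 0) : iteratedFDeriv ℝ n u x = 0 := by
  rcases hx.lt_or_eq with h0 | h0
  · have : u =ᶠ[𝓝 x] fun _ => 0 := by
      filter_upwards [continuous_snd.continuousAt.eventually_lt_const h0] with y hy
      exact hu.zero y (le_of_lt hy)
    rw [(this.iteratedFDeriv ℝ n).eq_of_nhds, iteratedFDeriv_fun_zero]
    rfl
  · have e : x = (x.1, 0) := Prod.ext rfl h0
    rw [e]
    exact (hu.flatGerm univ).iteratedFDeriv_eq_zero n (mem_univ _)

/-- Taylor's estimate along vertical segments. -/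
theorem GlobalFlat.exists_le_pow {u : ℝ × ℝ → ℝ} (hu : GlobalFlat u) (m : ℕ) : ∀ i : ℕ,
    ∃ C : ℝ, 0 ≤ C ∧ ∀ (x : ℝ × ℝ) (y : ℝ), 0 ≤ y → x.2 ≤ y →
      ‖iteratedFDeriv ℝ i u x‖ ≤ C * y ^ m := by
  induction m with
  | zero =>
    intro i
    obtain ⟨C, hC⟩ := hu.bdd i
    exact ⟨C, (norm_nonneg _).trans (hC 0), fun x y _ _ => by simpa using hC x⟩
  | succ m ih =>
    intro i
    obtain ⟨C, hC0, hC⟩ := ih (i + 1)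
    refine ⟨C, hC0, fun x y hy hxy => ?_⟩
    by_cases h0 : x.2 ≤ 0
    · rw [hu.iteratedFDeriv_of_nonpos i h0, norm_zero]; positivity
    push Not at h0
    have hconv : Convex ℝ {z : ℝ × ℝ | z.2 ≤ y} :=
      (convex_Iic y).linear_preimage (LinearMap.snd ℝ ℝ ℝ)
    have hd : Differentiable ℝ (iteratedFDeriv ℝ i u) :=
      hu.smooth.differentiable_iteratedFDeriv (by exact_mod_cast ENat.natCast_lt_top i)
    have key := hconv.norm_image_sub_le_of_norm_fderiv_le (𝕜 := ℝ) (f := iteratedFDeriv ℝ i u)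
      (C := C * y ^ m) (x := (x.1, 0)) (y := x) (fun z _ => hd z)
      (fun z hz => by rw [norm_fderiv_iteratedFDeriv]; exact hC z y hy hz) hy hxy
    rw [hu.iteratedFDeriv_of_nonpos i (x := (x.1, 0)) le_rfl, sub_zero] at key
    refine key.trans ?_
    have : ‖x - (x.1, 0)‖ ≤ y := by
      rw [Prod.norm_def]
      simpa [abs_of_pos h0] using ⟨hy, hxy⟩
    calc _ ≤ C * y ^ m * y := by gcongr
      _ = _ := by ring

theorem GlobalFlat.tameFlat {u : ℝ × ℝ → ℝ} (hu : GlobalFlat u) :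
    TameFlat (ContinuousLinearMap.snd ℝ ℝ ℝ) u := by
  refine ⟨hu.smooth, hu.zero, fun i q m => ?_⟩
  obtain ⟨C, -, hC⟩ := hu.exists_le_pow m i
  exact ⟨C, fun z h0 _ _ => hC z _ h0.le le_rfl⟩

theorem GlobalFlat.of_hasCompactSupport {u : ℝ × ℝ → ℝ} (hs : ContDiff ℝ ∞ u)
    (h0 : ∀ x : ℝ × ℝ, x.2 ≤ 0 → u x = 0) (hc : HasCompactSupport u) : GlobalFlat u :=
  ⟨hs, h0, fun n => Continuous.bounded_above_of_compact_support
    (hs.continuous_iteratedFDeriv (by exact_mod_cast le_top)) (hc.iteratedFDeriv n)⟩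

/-- A smooth step: `1` for `y ≤ 1/3` and `0` for `y ≥ 2/3`. -/
noncomputable def stepDown (y : ℝ) : ℝ := 1 - Real.smoothTransition (3 * y - 1)

theorem stepDown_of_le {y : ℝ} (h : y ≤ 1 / 3) : stepDown y = 1 := by
  rw [stepDown, Real.smoothTransition.zero_of_nonpos (by linarith), sub_zero]

theorem stepDown_of_ge {y : ℝ} (h : 2 / 3 ≤ y) : stepDown y = 0 := by
  rw [stepDown, Real.smoothTransition.one_of_one_le (by linarith), sub_self]

theorem contDiff_stepDown : ContDiff ℝ ∞ stepDown :=
  contDiff_const.sub (Real.smoothTransition.contDiff.comp (by fun_prop))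

theorem contDiff_stepDown_div (δ : ℝ) : ContDiff ℝ ∞ fun x : ℝ × ℝ => stepDown (x.2 / δ) :=
  contDiff_stepDown.comp (contDiff_snd.div_const δ)

/-- Cutting a flat function off at height `δ` makes it small in every `C^n` norm: the factor `δ⁻ⁿ`
from the cutoff is absorbed by flatness. -/
theorem GlobalFlat.eventually_norm_stepDown_mul_le {u : ℝ × ℝ → ℝ} (hu : GlobalFlat u) (n : ℕ)
    {ε : ℝ} (hε : 0 < ε) : ∀ᶠ δ in 𝓝[>] (0 : ℝ), ∀ x : ℝ × ℝ,
      ‖iteratedFDeriv ℝ n (fun x : ℝ × ℝ => stepDown (x.2 / δ) * u x) x‖ ≤ ε := by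
  have hc : ∀ i : ℕ, ∃ c : ℝ, ∀ y ∈ Icc (0 : ℝ) 1, ‖iteratedFDeriv ℝ i stepDown y‖ ≤ c := fun i =>
    isCompact_Icc.exists_bound_of_continuousOn
      (contDiff_stepDown.continuous_iteratedFDeriv (by exact_mod_cast le_top)).continuousOn
  choose c hc using hc
  have hc0 : ∀ i, 0 ≤ c i := fun i => (norm_nonneg _).trans (hc i 0 (by simp))
  choose C hC0 hC using fun i => hu.exists_le_pow (n + 1) i
  set D := ∑ i ∈ Finset.range (n + 1), (n.choose i : ℝ) * c i * C (n - i) with hD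
  have hD0 : 0 ≤ D := Finset.sum_nonneg fun i _ => by
    have := hc0 i
    have := hC0 (n - i)
    positivity
  have hpos : 0 < min 1 (ε / (D + 1)) := by positivity
  filter_upwards [Ioo_mem_nhdsGT hpos] with δ hδ x
  obtain ⟨hδ0, hδ1⟩ := hδ
  rw [lt_min_iff, lt_div_iff₀ (by positivity)] at hδ1
  by_cases h1 : x.2 ≤ 0
  · have : ∀ j, iteratedFDeriv ℝ j u x = 0 := fun j => hu.iteratedFDeriv_of_nonpos j h1
    refine (norm_iteratedFDeriv_mul_le (contDiff_stepDown_div δ) hu.smooth x (n := n)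
      (by exact_mod_cast le_top)).trans ?_
    simp only [this, norm_zero, mul_zero, Finset.sum_const_zero]
    exact hε.le
  push Not at h1
  by_cases h2 : x.2 < δ
  swap
  · have : (fun x : ℝ × ℝ => stepDown (x.2 / δ) * u x) =ᶠ[𝓝 x] fun _ => 0 := by
      have h3 : 2 / 3 * δ < x.2 := by linarith
      filter_upwards [continuous_snd.continuousAt.eventually_const_lt h3] with y hy
      rw [stepDown_of_ge ((le_div_iff₀ hδ0).mpr (le_of_lt hy)), zero_mul]
    rw [(this.iteratedFDeriv ℝ n).eq_of_nhds, iteratedFDeriv_fun_zero]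
    simpa using hε.le
  have hχ : ∀ i, ‖iteratedFDeriv ℝ i (fun x : ℝ × ℝ => stepDown (x.2 / δ)) x‖ ≤ c i * (1 / δ) ^ i := by
    intro i
    have h := (δ⁻¹ • ContinuousLinearMap.snd ℝ ℝ ℝ).iteratedFDeriv_comp_right contDiff_stepDown x
      (i := i) (by exact_mod_cast le_top)
    have e : stepDown ∘ (δ⁻¹ • ContinuousLinearMap.snd ℝ ℝ ℝ) =
        fun x : ℝ × ℝ => stepDown (x.2 / δ) := by
      ext z; simp [div_eq_inv_mul]
    have e' : (δ⁻¹ • ContinuousLinearMap.snd ℝ ℝ ℝ) x = x.2 / δ := by simp [div_eq_inv_mul]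
    rw [e, e'] at h
    rw [h]
    refine (ContinuousMultilinearMap.norm_compContinuousLinearMap_le _ _).trans ?_
    refine mul_le_mul (hc i _ ⟨by positivity, (div_le_one hδ0).mpr h2.le⟩) ?_ (by positivity) (hc0 i)
    rw [Finset.prod_const, Finset.card_univ, Fintype.card_fin]
    gcongr
    rw [norm_smul, norm_inv, Real.norm_of_nonneg hδ0.le, one_div]
    exact mul_le_of_le_one_right (by positivity) (ContinuousLinearMap.norm_snd_le ..)
  refine (norm_iteratedFDeriv_mul_le (contDiff_stepDown_div δ) hu.smooth x (n := n)
    (by exact_mod_cast le_top)).trans ?_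
  calc _ ≤ ∑ i ∈ Finset.range (n + 1), (n.choose i : ℝ) * c i * C (n - i) * δ := by
        refine Finset.sum_le_sum fun i hi => ?_
        have hin : i ≤ n := Nat.lt_succ_iff.mp (Finset.mem_range.mp hi)
        have hδp : (1 / δ) ^ i * δ ^ (n + 1) ≤ δ := by
          have : (1 / δ) ^ i * δ ^ (n + 1) = δ ^ (n - i) * δ := by
            have e : n + 1 = i + ((n - i) + 1) := by omega
            rw [e, pow_add, pow_add, pow_one, one_div, inv_pow]
            field_simp
          rw [this]
          exact mul_le_of_le_one_left hδ0.le (pow_le_one₀ hδ0.le hδ1.1.le)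
        have := hc0 i
        have := hC0 (n - i)
        calc _ ≤ (n.choose i : ℝ) * (c i * (1 / δ) ^ i) * (C (n - i) * δ ^ (n + 1)) := by
              gcongr
              · exact hχ i
              · exact hC (n - i) x δ hδ0.le h2.le
          _ = (n.choose i : ℝ) * c i * C (n - i) * ((1 / δ) ^ i * δ ^ (n + 1)) := by ring
          _ ≤ _ := by gcongr
    _ = D * δ := by rw [← Finset.sum_mul]
    _ ≤ ε := by nlinarith

/-- A locally finite smooth partition of unity on `I`, indexed by `ℕ`, with compact supports. -/
theorem exists_partition {I : Set ℝ} (hI : IsOpen I) : ∃ ρ : ℕ → ℝ → ℝ,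
    (∀ k, ContDiff ℝ ∞ (ρ k)) ∧ (∀ k, IsCompact (tsupport (ρ k))) ∧ (∀ k, tsupport (ρ k) ⊆ I) ∧
    ∀ t ∈ I, ∃ N : ℕ, ∀ᶠ s in 𝓝 t, (∀ k, N ≤ k → ρ k s = 0) ∧
      ∑ k ∈ Finset.range N, ρ k s = 1 := by
  obtain ⟨w₀, hw₀s, hw₀d, hw₀r⟩ := hI.exists_contDiff_support_eq (n := ⊤)
  have hw₀ : ∀ s, 0 ≤ w₀ s ∧ w₀ s ≤ 1 := fun s => hw₀r ⟨s, rfl⟩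
  -- `w` tends to zero both at the ends of `I` and at infinity
  set w : ℝ → ℝ := fun s => w₀ s / (1 + s ^ 2) with hw
  have hwd : ContDiff ℝ ∞ w := hw₀d.div (by fun_prop) fun s => by positivity
  have hw0 : ∀ s, 0 ≤ w s := fun s => div_nonneg (hw₀ s).1 (by positivity)
  set θ : ℕ → ℝ → ℝ := fun k s => Real.smoothTransition (k * w s - 1) with hθ
  have hθd : ∀ k, ContDiff ℝ ∞ (θ k) := fun k =>
    Real.smoothTransition.contDiff.comp ((contDiff_const.mul hwd).sub contDiff_const)
  have hclosed : ∀ k : ℕ, IsClosed {s : ℝ | 1 ≤ (k + 1 : ℝ) * w s} := fun k =>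
    isClosed_le continuous_const (continuous_const.mul hwd.continuous)
  have hsupp : ∀ k, tsupport (fun s => θ (k + 1) s - θ k s) ⊆ {s : ℝ | 1 ≤ (k + 1 : ℝ) * w s} := by
    intro k
    refine closure_minimal (fun s hs => ?_) (hclosed k)
    by_contra hlt
    have hlt' : (k + 1 : ℝ) * w s < 1 := not_le.mp hlt
    apply hs
    have h1 : θ (k + 1) s = 0 :=
      Real.smoothTransition.zero_of_nonpos (by push_cast; linarith)
    have h2 : θ k s = 0 :=
      Real.smoothTransition.zero_of_nonpos (by nlinarith [hw0 s])
    simp [h1, h2]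
  refine ⟨fun k s => θ (k + 1) s - θ k s, fun k => (hθd _).sub (hθd _), fun k => ?_, fun k s hs => ?_,
    fun t ht => ?_⟩
  · refine Metric.isCompact_of_isClosed_isBounded (isClosed_tsupport _) ?_
    refine (Metric.isBounded_closedBall (x := (0 : ℝ)) (r := k + 1)).subset fun s hs => ?_
    have h1 : 1 ≤ (k + 1 : ℝ) * w s := hsupp k hs
    have h2 : 1 + s ^ 2 ≤ k + 1 := by
      have h3 : w s * (1 + s ^ 2) ≤ 1 := by
        rw [hw]; simp only; rw [div_mul_cancel₀ _ (by positivity)]; exact (hw₀ s).2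
      nlinarith [sq_nonneg s, mul_le_mul_of_nonneg_right h1 (by positivity : (0 : ℝ) ≤ 1 + s ^ 2),
        mul_le_mul_of_nonneg_left h3 (by positivity : (0 : ℝ) ≤ k + 1)]
    rw [mem_closedBall_zero_iff, Real.norm_eq_abs]
    refine abs_le_of_sq_le_sq ?_ (by positivity)
    nlinarith [(Nat.cast_nonneg k : (0 : ℝ) ≤ k)]
  · have h1 : 1 ≤ (k + 1 : ℝ) * w s := hsupp k hs
    rw [← hw₀s, Function.mem_support]
    intro h0
    have : w s = 0 := by rw [hw]; simp [h0]
    rw [this] at h1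
    norm_num at h1
  · have hwt : 0 < w t := by
      have : w₀ t ≠ 0 := by rwa [← Function.mem_support, hw₀s]
      exact div_pos ((hw₀ t).1.lt_of_ne' this) (by positivity)
    obtain ⟨N, hN⟩ := exists_nat_gt (2 / w t)
    rw [div_lt_iff₀ hwt] at hN
    have hev : ∀ᶠ s in 𝓝 t, 2 < N * w s :=
      (continuous_const.mul hwd.continuous).continuousAt.eventually_const_lt hN
    refine ⟨N, ?_⟩
    filter_upwards [hev] with s hs
    have h1 : ∀ k, N ≤ k → θ k s = 1 := fun k hk => by
      have : (N : ℝ) * w s ≤ k * w s := mul_le_mul_of_nonneg_right (by exact_mod_cast hk) (hw0 s)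
      exact Real.smoothTransition.one_of_one_le (by linarith)
    refine ⟨fun k hk => by rw [h1 k hk, h1 (k + 1) (by omega), sub_self], ?_⟩
    rw [Finset.sum_range_sub (fun k => θ k s), h1 N le_rfl]
    have : θ 0 s = 0 := Real.smoothTransition.zero_of_nonpos (by simp)
    rw [this, sub_zero]

/-- Multiplying a flat germ by a compactly supported function of `τ` and cutting it off at a small
height gives a flat function on the plane, as small as desired. -/
theorem FlatGerm.exists_localization {I : Set ℝ} {u : ℝ × ℝ → ℝ} (hu : FlatGerm I u) {ρ : ℝ → ℝ}
    (hρ : ContDiff ℝ ∞ ρ) (hρc : IsCompact (tsupport ρ)) (hρI : tsupport ρ ⊆ I) (n : ℕ) {ε : ℝ}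
    (hε : 0 < ε) : ∃ f : ℝ × ℝ → ℝ, GlobalFlat f ∧
      (∀ j ≤ n, ∀ x, ‖iteratedFDeriv ℝ j f x‖ ≤ ε) ∧
      (∀ x : ℝ × ℝ, 1 ≤ |x.1| * x.2 → f x = 0) ∧ (∀ x : ℝ × ℝ, ρ x.1 = 0 → f x = 0) ∧
      ∃ η > 0, ∀ x : ℝ × ℝ, x.2 < η → f x = ρ x.1 * u x := by
  obtain ⟨r, hr, hsm⟩ := exists_forall_of_eventually hρc fun t ht => hu.smooth t (hρI ht)
  set u₁ : ℝ × ℝ → ℝ := fun x => stepDown (x.2 / r) * (ρ x.1 * u x) with hu₁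
  have hu₁s : ContDiff ℝ ∞ u₁ := by
    rw [contDiff_iff_contDiffAt]
    intro x
    by_cases hx : x.1 ∈ tsupport ρ
    swap
    · have : u₁ =ᶠ[𝓝 x] fun _ => 0 := by
        have ho : IsOpen (tsupport ρ)ᶜ := (isClosed_tsupport ρ).isOpen_compl
        filter_upwards [continuous_fst.continuousAt.eventually_mem (ho.mem_nhds hx)] with y hy
        simp [hu₁, image_eq_zero_of_notMem_tsupport hy]
      exact contDiffAt_const.congr_of_eventuallyEq this
    rcases lt_or_ge |x.2| r with h1 | h1
    · exact (contDiff_stepDown_div r).contDiffAt.mul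
        ((hρ.comp contDiff_fst).contDiffAt.mul (hsm x.1 hx x.2 h1))
    · refine contDiffAt_const (c := (0 : ℝ)).congr_of_eventuallyEq ?_
      rcases le_abs.mp h1 with h2 | h2
      · have h3 : 2 / 3 * r < x.2 := by linarith
        filter_upwards [continuous_snd.continuousAt.eventually_const_lt h3] with y hy
        simp only [hu₁]
        rw [stepDown_of_ge ((le_div_iff₀ hr).mpr (le_of_lt hy)), zero_mul]
      · have h3 : x.2 < 0 := by linarith
        filter_upwards [continuous_snd.continuousAt.eventually_lt_const h3] with y hy
        simp only [hu₁]
        rw [hu.zero y (le_of_lt hy), mul_zero, mul_zero]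
  have hu₁0 : ∀ x : ℝ × ℝ, x.2 ≤ 0 → u₁ x = 0 := fun x hx => by
    simp only [hu₁]; rw [hu.zero x hx, mul_zero, mul_zero]
  have hu₁c : HasCompactSupport u₁ := by
    refine HasCompactSupport.intro (hρc.prod (isCompact_Icc (a := (0 : ℝ)) (b := r))) fun x hx => ?_
    by_cases h1 : x.1 ∈ tsupport ρ
    · by_cases h2 : x.2 ≤ 0
      · exact hu₁0 x h2
      · have h3 : r < x.2 := by
          by_contra h3
          exact hx ⟨h1, (not_le.mp h2).le, not_lt.mp h3⟩
        simp only [hu₁]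
        rw [stepDown_of_ge ((le_div_iff₀ hr).mpr (by linarith)), zero_mul]
    · simp only [hu₁]
      rw [image_eq_zero_of_notMem_tsupport h1, zero_mul, mul_zero]
  have hG := GlobalFlat.of_hasCompactSupport hu₁s hu₁0 hu₁c
  obtain ⟨L, hL0, hL⟩ := hρc.isBounded.exists_pos_norm_le
  have hev : ∀ᶠ δ in 𝓝[>] (0 : ℝ), ∀ j ∈ Iic n, ∀ x : ℝ × ℝ,
      ‖iteratedFDeriv ℝ j (fun x : ℝ × ℝ => stepDown (x.2 / δ) * u₁ x) x‖ ≤ ε :=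
    (finite_Iic n).eventually_all.mpr fun j _ => hG.eventually_norm_stepDown_mul_le j hε
  obtain ⟨δ, hδ, hδ0, hδL⟩ := (hev.and (Ioo_mem_nhdsGT (show 0 < 1 / L by positivity))).exists
  rw [lt_div_iff₀ hL0] at hδL
  refine ⟨fun x => stepDown (x.2 / δ) * u₁ x, ?_, fun j hj x => hδ j hj x, fun x hx => ?_,
    fun x hx => by simp [hu₁, hx], min (δ / 3) (r / 3), by positivity, fun x hx => ?_⟩
  · exact GlobalFlat.of_hasCompactSupport ((contDiff_stepDown_div δ).mul hu₁s)
      (fun x hx => by simp [hu₁0 x hx]) hu₁c.mul_left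
  · by_cases h1 : x.1 ∈ tsupport ρ
    · change stepDown (x.2 / δ) * u₁ x = 0
      have h2 : δ ≤ x.2 := by
        by_contra! h2
        have h3 : |x.1| ≤ L := hL x.1 h1
        have h4 : 0 < x.2 := by
          by_contra! h4
          nlinarith [abs_nonneg x.1]
        nlinarith [abs_nonneg x.1]
      rw [stepDown_of_ge ((le_div_iff₀ hδ0).mpr (by linarith)), zero_mul]
    · simp [hu₁, image_eq_zero_of_notMem_tsupport h1]
  · rw [lt_min_iff] at hx
    simp only [hu₁]
    rw [stepDown_of_le ((div_le_iff₀ hδ0).mpr (by linarith)),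
      stepDown_of_le ((div_le_iff₀ hr).mpr (by linarith)), one_mul, one_mul]

/-- Every flat germ along `J` is the germ of a flat function on the whole plane with bounded
derivatives and small differential, which moreover vanishes where `|τ| φ ≥ 1`. -/
theorem FlatGerm.exists_globalFlat {I : Set ℝ} (hI : IsOpen I) {u : ℝ × ℝ → ℝ} (hu : FlatGerm I u)
    {ε : ℝ} (hε : 0 < ε) : ∃ U : ℝ × ℝ → ℝ, GlobalFlat U ∧ (∀ x, ‖fderiv ℝ U x‖ ≤ ε) ∧
      (∀ x : ℝ × ℝ, 1 ≤ |x.1| * x.2 → U x = 0) ∧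
      ∀ t ∈ I, ∀ᶠ x in 𝓝 ((t, 0) : ℝ × ℝ), U x = u x := by
  obtain ⟨ρ, hρd, hρc, hρI, hρN⟩ := exists_partition hI
  choose f hf hfε hf0 hfρ η hη0 hη using fun k : ℕ =>
    hu.exists_localization (hρd k) (hρc k) (hρI k) (k + 1) (show 0 < ε / 2 / 2 ^ k by positivity)
  choose C hC using fun (n k : ℕ) => (hf k).bdd n
  -- the derivatives of order `n` of `f k` are controlled geometrically as soon as `n ≤ k + 1`
  set b : ℕ → ℕ → ℝ := fun n k => if n ≤ k + 1 then ε / 2 / 2 ^ k else C n k with hb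
  have hbd : ∀ n k x, ‖iteratedFDeriv ℝ n (f k) x‖ ≤ b n k := by
    intro n k x
    simp only [hb]
    split_ifs with h
    · exact hfε k n h x
    · exact hC n k x
  have hbs : ∀ n, Summable (b n) := by
    intro n
    have : b n =ᶠ[Filter.cofinite] fun k => ε / 2 / 2 ^ k := by
      rw [Nat.cofinite_eq_atTop]
      filter_upwards [Filter.eventually_ge_atTop n] with k hk
      simp only [hb]
      rw [if_pos (by omega)]
    exact (summable_congr_cofinite this).mpr (summable_geometric_two' ε)
  have hD : ∀ n : ℕ, iteratedFDeriv ℝ n (fun x => ∑' k, f k x) =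
      fun x => ∑' k, iteratedFDeriv ℝ n (f k) x := fun n =>
    iteratedFDeriv_tsum (N := ⊤) (fun k => (hf k).smooth) (fun n _ => hbs n)
      (fun n k x _ => hbd n k x) (by exact_mod_cast le_top)
  have hnorm : ∀ n x, ‖iteratedFDeriv ℝ n (fun x => ∑' k, f k x) x‖ ≤ ∑' k, b n k := by
    intro n x
    rw [hD n]
    exact tsum_of_norm_bounded (hbs n).hasSum fun k => hbd n k x
  refine ⟨fun x => ∑' k, f k x, ⟨?_, fun x hx => ?_, fun n => ⟨_, hnorm n⟩⟩, fun x => ?_, fun x hx => ?_,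
    fun t ht => ?_⟩
  · exact contDiff_tsum (N := ⊤) (fun k => (hf k).smooth) (fun n _ => hbs n)
      (fun n k x _ => hbd n k x)
  · simp [(hf _).zero x hx]
  · have := hnorm 1 x
    rw [← norm_iteratedFDeriv_fderiv, norm_iteratedFDeriv_zero] at this
    refine this.trans (le_of_eq ?_)
    rw [← tsum_geometric_two' ε]
    exact tsum_congr fun k => if_pos (by omega)
  · simp [hf0 _ x hx]
  · obtain ⟨N, hN⟩ := hρN t ht
    have e1 := (continuous_fst (X := ℝ) (Y := ℝ)).continuousAt (x := (t, 0)) |>.eventually hN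
    have e2 : ∀ᶠ x in 𝓝 ((t, 0) : ℝ × ℝ), ∀ k ∈ Iio N, x.2 < η k :=
      (finite_Iio N).eventually_all.mpr fun k _ =>
        continuous_snd.continuousAt.eventually_lt_const (hη0 k)
    filter_upwards [e1, e2] with x h1 h2
    rw [tsum_eq_sum (s := Finset.range N) fun k hk => hfρ k x (h1.1 k (by simpa using hk)),
      Finset.sum_congr rfl fun k hk => hη k x (h2 k (Finset.mem_range.mp hk)), ← Finset.sum_mul,
      h1.2, one_mul]

/-! ### The cohomological equation `v ∘ F - v = g` -/

/-- The linear shear `(τ, φ) ↦ (τ + φ, φ)`. -/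
def shear : ℝ × ℝ →L[ℝ] ℝ × ℝ :=
  (ContinuousLinearMap.fst ℝ ℝ ℝ + ContinuousLinearMap.snd ℝ ℝ ℝ).prod
    (ContinuousLinearMap.snd ℝ ℝ ℝ)

theorem shear_apply (x : ℝ × ℝ) : shear x = (x.1 + x.2, x.2) := rfl

theorem shear_pow_apply (n : ℕ) (x : ℝ × ℝ) : (shear ^ n) x = (x.1 + n * x.2, x.2) := by
  induction n with
  | zero => simp
  | succ n ih =>
    rw [pow_succ', mul_apply_eq_comp, ih, shear_apply]
    ext
    · simp; ring
    · rfl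

theorem norm_shear_pow_le (n : ℕ) : ‖shear ^ n‖ ≤ n + 1 := by
  refine ContinuousLinearMap.opNorm_le_bound _ (by positivity) fun x => ?_
  rw [shear_pow_apply, Prod.norm_def]
  have h1 := norm_fst_le x
  have h2 := norm_snd_le x
  refine max_le ?_ ?_
  · calc ‖x.1 + n * x.2‖ ≤ ‖x.1‖ + ‖(n : ℝ) * x.2‖ := norm_add_le _ _
      _ = ‖x.1‖ + n * ‖x.2‖ := by rw [norm_mul, Real.norm_natCast]
      _ ≤ ‖x‖ + n * ‖x‖ := by gcongr
      _ = _ := by ring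
  · nlinarith [norm_nonneg x, mul_nonneg (Nat.cast_nonneg (α := ℝ) n) (norm_nonneg x)]

/-- A flat perturbation of the shear that is trivial where `|τ| φ ≥ 1` is a shear system: orbits
reach this region within `φ ^ (-3)` steps, and never leave it again. -/
theorem isShearSystem_of_globalFlat {A B g : ℝ × ℝ → ℝ} (hA : GlobalFlat A) (hB : GlobalFlat B)
    (hg : GlobalFlat g) (hA0 : ∀ x : ℝ × ℝ, 1 ≤ |x.1| * x.2 → A x = 0)
    (hB0 : ∀ x : ℝ × ℝ, 1 ≤ |x.1| * x.2 → B x = 0)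
    (hg0 : ∀ x : ℝ × ℝ, 1 ≤ |x.1| * x.2 → g x = 0) :
    IsShearSystem (ContinuousLinearMap.snd ℝ ℝ ℝ) shear (fun x => (A x, B x)) g := by
  have hR := hA.tameFlat.prodMk hB.tameFlat
  have hinv : ∀ z, ContinuousLinearMap.snd ℝ ℝ ℝ (shear z) = ContinuousLinearMap.snd ℝ ℝ ℝ z :=
    fun _ => rfl
  refine ⟨hinv, norm_shear_pow_le, hR, hg.tameFlat, fun M => ?_⟩
  obtain ⟨δ, hδ, hδ1, hsh⟩ := hR.exists_shadowing hinv norm_shear_pow_le (max M 0)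
    (le_max_right _ _) 0
  set M' := max M 0 with hM'
  have hM0 : 0 ≤ M' := le_max_right _ _
  set Φ : ℝ × ℝ → ℝ × ℝ := fun y => shear y + (A y, B y) with hΦ
  have habs : ∀ (n : ℕ) (x : ℝ × ℝ), 0 ≤ x.1 → 0 < x.2 → 1 ≤ x.1 * x.2 →
      0 ≤ (Φ^[n] x).1 ∧ 0 < (Φ^[n] x).2 ∧ 1 ≤ (Φ^[n] x).1 * (Φ^[n] x).2 := by
    intro n x h1 h2 h3
    induction n with
    | zero => exact ⟨h1, h2, h3⟩
    | succ n ih =>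
      obtain ⟨i1, i2, i3⟩ := ih
      rw [Function.iterate_succ_apply']
      set y := Φ^[n] x
      have hy : 1 ≤ |y.1| * y.2 := by rwa [abs_of_nonneg i1]
      have e : Φ y = (y.1 + y.2, y.2) := by
        rw [hΦ]; simp [shear_apply, hA0 y hy, hB0 y hy]
      rw [e]
      exact ⟨by simp only; linarith, i2, by simp only; nlinarith⟩
  refine ⟨min δ (1 / (M' + 4)), by positivity, fun z hz h0 h1 n hn => ?_⟩
  rw [lt_min_iff, lt_div_iff₀ (by positivity)] at h1
  have h0' : 0 < z.2 := h0
  have hn' : 1 < n * z.2 ^ 3 := hn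
  have h12 : z.2 * (M' + 4) < 1 := h1.2
  set s := z.2 with hs
  -- the first step after which the orbit is certain to have left the support
  set k := ⌊1 / s ^ 3⌋₊ + 1 with hk
  have hs4 : s ≤ 1 / 4 := by nlinarith
  have hk1 : 1 < k * s ^ 3 := by
    have := Nat.lt_floor_add_one (1 / s ^ 3)
    rw [div_lt_iff₀ (by positivity)] at this
    exact_mod_cast this
  have hs3 : s ^ 3 ≤ 1 := pow_le_one₀ h0'.le (by linarith)
  have hk2 : (k : ℝ) * s ^ 4 ≤ 1 := by
    have := Nat.floor_le (a := 1 / s ^ 3) (by positivity)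
    rw [le_div_iff₀ (by positivity)] at this
    calc (k : ℝ) * s ^ 4 = (⌊1 / s ^ 3⌋₊ * s ^ 3 + s ^ 3) * s := by rw [hk]; push_cast; ring
      _ ≤ (1 + 1) * (1 / 4) := by gcongr
      _ ≤ 1 := by norm_num
  have hkn : k ≤ n := by
    have : 1 / s ^ 3 < n := by rwa [div_lt_iff₀ (by positivity)]
    exact (Nat.floor_lt (by positivity)).mpr this
  obtain ⟨e1, e2, -, -⟩ := hsh z (hz.le.trans (le_max_left _ _)) h0 h1.1 k hk2
  have e2' : s / 2 ≤ (Φ^[k] z).2 := e2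
  have e3 : |(Φ^[k] z).1 - (z.1 + k * s)| ≤ s ^ 2 := by
    have := (norm_fst_le (Φ^[k] z - (shear ^ k) z)).trans e1
    rw [shear_pow_apply] at this
    exact this
  have hz1 : |z.1| ≤ M' := (norm_fst_le z).trans (hz.le.trans (le_max_left _ _))
  rw [abs_le] at e3 hz1
  have hsq : s ^ 2 ≤ 1 := pow_le_one₀ h0'.le (by linarith)
  have hks : (M' + 4) < k * s ^ 2 := by
    have : (M' + 4) * s < k * s ^ 2 * s := by nlinarith
    exact lt_of_mul_lt_mul_right this h0'.le
  have hks' : 1 < (k * s) * s ^ 2 := by nlinarith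
  have hT : 2 ≤ (Φ^[k] z).1 * s := by
    have h5 : -M' + k * s - s ^ 2 ≤ (Φ^[k] z).1 := by linarith
    have h6 : (-M' + k * s - s ^ 2) * s ≤ (Φ^[k] z).1 * s := by gcongr
    have h7 : M' * s ≤ 1 := by nlinarith
    have h8 : s ^ 2 * s ≤ 1 := by nlinarith
    nlinarith
  have hT0 : 0 ≤ (Φ^[k] z).1 := by
    by_contra! hneg
    nlinarith
  obtain ⟨a1, a2, a3⟩ := habs (n - k) (Φ^[k] z) hT0 (by linarith) (by nlinarith)
  rw [← Function.iterate_add_apply, Nat.sub_add_cancel hkn] at a1 a2 a3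
  exact hg0 _ (by rwa [abs_of_nonneg a1])

/-- The cohomological equation over a flat perturbation of the shear, with flat right-hand side, has
a flat solution. -/
theorem exists_flatGerm_coboundary {I : Set ℝ} (hI : IsOpen I) {a b g : ℝ × ℝ → ℝ}
    (ha : FlatGerm I a) (hb : FlatGerm I b) (hg : FlatGerm I g) :
    ∃ v, FlatGerm I v ∧ ∀ t ∈ I, ∀ᶠ x in 𝓝 ((t, 0) : ℝ × ℝ), 0 < x.2 →
      0 < x.2 + b x ∧ v (x.1 + x.2 + a x, x.2 + b x) = v x + g x := by
  obtain ⟨A, hA, -, hA0, hAa⟩ := ha.exists_globalFlat hI one_pos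
  obtain ⟨B, hB, -, hB0, hBb⟩ := hb.exists_globalFlat hI one_pos
  obtain ⟨G, hG, -, hG0, hGg⟩ := hg.exists_globalFlat hI one_pos
  have hS := isShearSystem_of_globalFlat hA hB hG hA0 hB0 hG0
  set ℓ := ContinuousLinearMap.snd ℝ ℝ ℝ with hℓ
  set Φ : ℝ × ℝ → ℝ × ℝ := fun y => shear y + (A y, B y) with hΦ
  have hnear : ∀ (t : ℝ) {δ : ℝ}, 0 < δ → ∀ᶠ x in 𝓝 ((t, 0) : ℝ × ℝ), ‖x‖ < |t| + 1 ∧ x.2 < δ := by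
    intro t δ hδ
    refine (continuous_norm.continuousAt.eventually_lt_const ?_).and
      (continuous_snd.continuousAt.eventually_lt_const hδ)
    change ‖((t, 0) : ℝ × ℝ)‖ < |t| + 1
    rw [Prod.norm_def]
    simp only [Real.norm_eq_abs, abs_zero]
    exact max_lt (by linarith) (by positivity)
  refine ⟨orbitSum ℓ Φ G, ⟨fun x hx => orbitSum_of_nonpos hx, fun t _ => ?_⟩, fun t ht => ?_⟩
  · obtain ⟨δ, hδ, hint⟩ := hS.orbitSum_interior (|t| + 1)
    filter_upwards [hnear t hδ] with x hx
    rcases lt_trichotomy x.2 0 with h0 | h0 | h0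
    · exact contDiffAt_const.congr_of_eventuallyEq (orbitSum_eventuallyEq_zero h0)
    · exact contDiffAt_infty.mpr fun k => IsShearSystem.contDiffAt_boundary k hS x h0
    · exact (hint x hx.1 h0 hx.2).1
  · obtain ⟨δ₁, hδ₁, hex⟩ := hS.exists_eventually_zero (|t| + 1)
    obtain ⟨δ₂, hδ₂, hδ₂1, hsh⟩ := hS.flat.exists_shadowing hS.inv hS.growth (|t| + 1)
      (by positivity) 0
    filter_upwards [hnear t hδ₁, hnear t hδ₂, hAa t ht, hBb t ht, hGg t ht] with x h1 h2 eA eB eG h0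
    obtain ⟨-, N, hN⟩ := hex x h1.1 h0 h1.2
    obtain ⟨-, hN⟩ := hN.self_of_nhds
    have hx4 : x.2 ^ 4 ≤ 1 := pow_le_one₀ h0.le (by linarith [h2.2])
    obtain ⟨-, s1, -, -⟩ := hsh x h1.1.le h0 h2.2 1 (by rw [Nat.cast_one, one_mul]; exact hx4)
    have eΦ : Φ x = (x.1 + x.2 + a x, x.2 + b x) := by
      rw [← eA, ← eB]; rfl
    have hpos : 0 < ℓ (Φ x) := lt_of_lt_of_le (half_pos h0) s1
    refine ⟨?_, ?_⟩
    · have : ℓ (Φ x) = x.2 + b x := by rw [eΦ]; rfl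
      rwa [this] at hpos
    · rw [← eΦ, ← eG, orbitSum_eq_sum hpos (N := N), orbitSum_eq_sum (N := N + 1) h0,
        Finset.sum_range_succ']
      · simp only [Function.iterate_succ_apply, Function.iterate_zero, id_eq]
        ring
      · exact fun n hn => hN n (by omega)
      · intro n hn
        rw [← Function.iterate_succ_apply]
        exact hN (n + 1) (by omega)

/-! ### Normal form of the map near the boundary -/

theorem FlatGerm.neg {I : Set ℝ} {u : ℝ × ℝ → ℝ} (hu : FlatGerm I u) :
    FlatGerm I fun x => -u x :=
  ⟨fun x hx => by rw [hu.zero x hx, neg_zero], fun t ht => (hu.smooth t ht).mono fun _ h => h.neg⟩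

theorem FlatGerm.sub {I : Set ℝ} {u v : ℝ × ℝ → ℝ} (hu : FlatGerm I u) (hv : FlatGerm I v) :
    FlatGerm I fun x => u x - v x :=
  ⟨fun x hx => by rw [hu.zero x hx, hv.zero x hx, sub_zero], fun t ht =>
    ((hu.smooth t ht).and (hv.smooth t ht)).mono fun _ h => h.1.sub h.2⟩

theorem FlatGerm.eventually_norm_fderiv_lt {I : Set ℝ} {u : ℝ × ℝ → ℝ} (hu : FlatGerm I u) {ε : ℝ}
    (hε : 0 < ε) {t : ℝ} (ht : t ∈ I) : ∀ᶠ x in 𝓝 ((t, 0) : ℝ × ℝ), ‖fderiv ℝ u x‖ < ε := by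
  have hc : ContinuousAt (iteratedFDeriv ℝ 1 u) (t, 0) :=
    (hu.smooth t ht).self_of_nhds.continuousAt_iteratedFDeriv (by exact_mod_cast le_top)
  have h0 : ‖iteratedFDeriv ℝ 1 u (t, 0)‖ < ε := by
    rwa [hu.iteratedFDeriv_eq_zero 1 ht, norm_zero]
  filter_upwards [hc.norm.eventually_lt_const h0] with x hx
  rwa [← norm_iteratedFDeriv_zero (𝕜 := ℝ) (f := fderiv ℝ u), norm_iteratedFDeriv_fderiv]

theorem IsFlat.mono {I : Set ℝ} {V W : Set (ℝ × ℝ)} {f : ℝ × ℝ → ℝ} (hf : IsFlat I V f)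
    (h : W ⊆ V) : IsFlat I W f := by
  refine ⟨hf.smooth.mono (union_subset_union_left _ h), hf.zero, fun n K hK hKI ε hε => ?_⟩
  obtain ⟨δ, hδ, hb⟩ := hf.decay n K hK hKI ε hε
  exact ⟨δ, hδ, fun s hs y hy hyδ hW => hb s hs y hy hyδ (h hW)⟩

theorem IsAdjacentDomain.exists_subset {I : Set ℝ} (hI : IsOpen I) (hIc : I.OrdConnected)
    (hIn : I.Nonempty) {W : Set (ℝ × ℝ)} (hW : IsAdjacentDomain I W) {p : ℝ × ℝ → Prop}
    (h : ∀ t ∈ I, ∀ᶠ x in 𝓝 ((t, 0) : ℝ × ℝ), 0 < x.2 → p x) :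
    ∃ W' ⊆ W, IsAdjacentDomain I W' ∧ ∀ x ∈ W', p x := by
  obtain ⟨W', hW', hp⟩ := exists_isAdjacentDomain hI hIc hIn (p := fun x => x ∈ W ∧ p x)
    fun t ht => ((hW.eventually_mem ht).and (h t ht)).mono fun x hx h0 => ⟨hx.1 h0, hx.2 h0⟩
  exact ⟨W', fun x hx => (hp x hx).2.1, hW', fun x hx => (hp x hx).2.2⟩

/-- An invariant function `φ + u` with `u` flat and `‖Du‖ < 1` is a flat integral. -/
theorem FlatGerm.isFlatIntegral {F : ℝ × ℝ → ℝ × ℝ} {I : Set ℝ} {W : Set (ℝ × ℝ)}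
    (hW : IsAdjacentDomain I W) {u : ℝ × ℝ → ℝ} (hu : FlatGerm I u)
    (hs : ∀ x ∈ W, ContDiffAt ℝ ∞ u x) (hD : ∀ x ∈ W, ‖fderiv ℝ u x‖ < 1)
    (hinv : IsInvariantOn F (W ∪ bdry I) fun x => x.2 + u x) :
    IsFlatIntegral F I W fun x => x.2 + u x := by
  refine ⟨contDiff_snd.contDiffOn.add (hu.contDiffOn hs),
    hu.isFlat hW hs fun x _ => by ring, fun x hx => ?_, hinv⟩
  have hux : ContDiffAt ℝ ∞ u x ∧ ‖fderiv ℝ u x‖ < 1 := by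
    rcases hx with hx | hx
    · exact ⟨hs x hx, hD x hx⟩
    · have e : x = (x.1, 0) := Prod.ext rfl hx.2
      rw [e]
      exact ⟨(hu.smooth _ hx.1).self_of_nhds,
        (hu.eventually_norm_fderiv_lt one_pos hx.1).self_of_nhds⟩
  have hdu : DifferentiableAt ℝ u x := hux.1.differentiableAt (by simp)
  rw [fderivWithin_eq_fderiv (hW.uniqueDiffWithinAt hx) (differentiableAt_snd.fun_add hdu),
    fderiv_fun_add differentiableAt_snd hdu, fderiv_snd]
  have h1 := (fderiv ℝ u x).le_opNorm (0, 1)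
  rw [Prod.norm_def] at h1
  simp only [norm_zero, norm_one, Real.norm_eq_abs] at h1
  have h2 := neg_abs_le ((fderiv ℝ u x) (0, 1))
  rw [max_eq_right zero_le_one, mul_one] at h1
  change 0 < (1 : ℝ) + (fderiv ℝ u x) (0, 1)
  linarith [hux.2]

theorem apply_of_mem_bdry {F : ℝ × ℝ → ℝ × ℝ} {I : Set ℝ} {V : Set (ℝ × ℝ)}
    (h1 : IsFlat I V fun x => (F x).1 - (x.1 + x.2)) (h2 : IsFlat I V fun x => (F x).2 - x.2)
    {x : ℝ × ℝ} (hx : x ∈ bdry I) : F x = x := by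
  have e1 : (F x).1 - (x.1 + x.2) = 0 := h1.zero x hx
  have e2 : (F x).2 - x.2 = 0 := h2.zero x hx
  have e3 : x.2 = 0 := hx.2
  ext <;> linarith

/-- Existence of a flat integral: `u = φ~ - φ` solves a cohomological equation. -/
theorem exists_isFlatIntegral {F : ℝ × ℝ → ℝ × ℝ} {I : Set ℝ} (hI : IsOpen I)
    (hIc : I.OrdConnected) (hIn : I.Nonempty) {V : Set (ℝ × ℝ)} (hV : IsAdjacentDomain I V)
    (h1 : IsFlat I V fun x => (F x).1 - (x.1 + x.2)) (h2 : IsFlat I V fun x => (F x).2 - x.2) :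
    ∃ W ⊆ V, IsAdjacentDomain I W ∧ ∃ f : ℝ × ℝ → ℝ, IsFlatIntegral F I W f := by
  set a := zeroExt fun x => (F x).1 - (x.1 + x.2) with ha
  set b := zeroExt fun x => (F x).2 - x.2 with hb
  have hag : FlatGerm I a := h1.flatGerm hI hV
  have hbg : FlatGerm I b := h2.flatGerm hI hV
  obtain ⟨v, hv, hveq⟩ := exists_flatGerm_coboundary hI hag hbg hbg.neg
  obtain ⟨W, hWV, hW, hp⟩ := hV.exists_subset hI hIc hIn
    (p := fun x => (0 < x.2 + b x ∧ v (x.1 + x.2 + a x, x.2 + b x) = v x + -b x) ∧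
      ContDiffAt ℝ ∞ v x ∧ ‖fderiv ℝ v x‖ < 1)
    fun t ht => by
      filter_upwards [hveq t ht, hv.smooth t ht, hv.eventually_norm_fderiv_lt one_pos ht]
        with x e1 e2 e3 h0 using ⟨e1 h0, e2, e3⟩
  refine ⟨W, hWV, hW, fun x => x.2 + v x, hv.isFlatIntegral hW (fun x hx => (hp x hx).2.1)
    (fun x hx => (hp x hx).2.2) fun x hx _ => ?_⟩
  rcases hx with hx | hx
  · have h0 := hW.pos x hx
    have ea : a x = (F x).1 - (x.1 + x.2) := zeroExt_of_pos h0
    have eb : b x = (F x).2 - x.2 := zeroExt_of_pos h0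
    have e : (x.1 + x.2 + a x, x.2 + b x) = F x := by
      rw [ea, eb]; ext <;> simp
    have := (hp x hx).1.2
    rw [e] at this
    simp only
    rw [this, eb]; ring
  · rw [apply_of_mem_bdry h1 h2 hx]

/-- A pair of flat germs `(v, u)` gives the germ along `J` of a diffeomorphism of the whole plane,
`(τ, φ) ↦ (τ + v, φ + u)`, which is the identity for `φ ≤ 0`. -/
theorem FlatGerm.exists_homeomorph {I : Set ℝ} (hI : IsOpen I) {v u : ℝ × ℝ → ℝ}
    (hv : FlatGerm I v) (hu : FlatGerm I u) : ∃ H : (ℝ × ℝ) ≃ₜ (ℝ × ℝ), ContDiff ℝ ∞ H ∧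
      ContDiff ℝ ∞ H.symm ∧ (∀ x : ℝ × ℝ, x.2 ≤ 0 → H x = x) ∧
      ∀ t ∈ I, ∀ᶠ x in 𝓝 ((t, 0) : ℝ × ℝ), H x = (x.1 + v x, x.2 + u x) := by
  obtain ⟨A, hA, hAd, -, hAv⟩ := hv.exists_globalFlat hI (ε := 1 / 2) (by norm_num)
  obtain ⟨B, hB, hBd, -, hBu⟩ := hu.exists_globalFlat hI (ε := 1 / 2) (by norm_num)
  set P : ℝ × ℝ → ℝ × ℝ := fun x => (A x, B x) with hP
  have hPs : ContDiff ℝ ∞ P := hA.smooth.prodMk hB.smooth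
  have hPd : Differentiable ℝ P := hPs.differentiable (by simp)
  have hPn : ∀ x, ‖fderiv ℝ P x‖ ≤ 1 / 2 := by
    intro x
    have : fderiv ℝ P x = (fderiv ℝ A x).prod (fderiv ℝ B x) :=
      ((hA.smooth.differentiable (by simp) x).hasFDerivAt.prodMk
        (hB.smooth.differentiable (by simp) x).hasFDerivAt).fderiv
    rw [this, ContinuousLinearMap.opNorm_prod]
    exact max_le (hAd x) (hBd x)
  have happ : ApproximatesLinearOn (fun x => x + P x)
      (ContinuousLinearEquiv.refl ℝ (ℝ × ℝ) : ℝ × ℝ →L[ℝ] ℝ × ℝ) univ (1 / 2) := by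
    intro x _ y _
    have e : x + P x - (y + P y) - (ContinuousLinearEquiv.refl ℝ (ℝ × ℝ) : ℝ × ℝ →L[ℝ] ℝ × ℝ) (x - y)
        = P x - P y := by
      simp only [ContinuousLinearEquiv.coe_refl, ContinuousLinearMap.coe_id', id_eq]; abel
    rw [e]
    have := convex_univ.norm_image_sub_le_of_norm_fderiv_le (𝕜 := ℝ) (f := P) (x := y) (y := x)
      (fun z _ => hPd z) (fun z _ => hPn z) (mem_univ _) (mem_univ _)
    simpa using this
  have hc : Subsingleton (ℝ × ℝ) ∨ (1 / 2 : NNReal) <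
      ‖((ContinuousLinearEquiv.refl ℝ (ℝ × ℝ)).symm : ℝ × ℝ →L[ℝ] ℝ × ℝ)‖₊⁻¹ := by
    right
    have : ‖((ContinuousLinearEquiv.refl ℝ (ℝ × ℝ)).symm : ℝ × ℝ →L[ℝ] ℝ × ℝ)‖₊ = 1 := by
      ext
      exact ContinuousLinearMap.norm_id
    rw [this, inv_one]
    exact NNReal.half_lt_self one_ne_zero
  set H := happ.toHomeomorph _ hc with hH
  have hHx : ∀ x, H x = x + P x := fun x => rfl
  have hHs : ContDiff ℝ ∞ H := contDiff_id.add hPs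
  have hlt : ∀ x, ‖-fderiv ℝ P x‖ < 1 := fun x => by
    rw [norm_neg]; exact (hPn x).trans_lt (by norm_num)
  refine ⟨H, hHs, H.contDiff_symm (f₀' := fun x =>
    ContinuousLinearEquiv.unitsEquiv ℝ (ℝ × ℝ) (Units.oneSub (-fderiv ℝ P x) (hlt x)))
      (fun x => ?_) hHs, fun x hx => ?_, fun t ht => ?_⟩
  · have e : ((ContinuousLinearEquiv.unitsEquiv ℝ (ℝ × ℝ) (Units.oneSub (-fderiv ℝ P x) (hlt x)) :
        (ℝ × ℝ) ≃L[ℝ] (ℝ × ℝ)) : ℝ × ℝ →L[ℝ] ℝ × ℝ) =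
        ContinuousLinearMap.id ℝ (ℝ × ℝ) + fderiv ℝ P x := by
      apply ContinuousLinearMap.ext
      intro w
      simp [ContinuousLinearEquiv.unitsEquiv_apply, Units.val_oneSub]
    rw [e]
    exact (hasFDerivAt_id x).add (hPd x).hasFDerivAt
  · rw [hHx, hP]; simp [hA.zero x hx, hB.zero x hx]
  · filter_upwards [hAv t ht, hBu t ht] with x e1 e2
    rw [hHx, hP]; simp only; rw [e1, e2]; rfl

/-- Given a flat integral `f`, a solution `v = τ~ - τ` of a cohomological equation completes it to
coordinates in which `F` is the shear; they extend to a diffeomorphism `H` of the plane. -/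
theorem IsFlatIntegral.exists_normal_form {F : ℝ × ℝ → ℝ × ℝ} {I : Set ℝ} (hI : IsOpen I)
    (hIc : I.OrdConnected) (hIn : I.Nonempty) {W : Set (ℝ × ℝ)} (hW : IsAdjacentDomain I W)
    (h1 : IsFlat I W fun x => (F x).1 - (x.1 + x.2)) (h2 : IsFlat I W fun x => (F x).2 - x.2)
    {f : ℝ × ℝ → ℝ} (hf : IsFlatIntegral F I W f) :
    ∃ (v : ℝ × ℝ → ℝ) (H : (ℝ × ℝ) ≃ₜ (ℝ × ℝ)), FlatGerm I v ∧ ContDiff ℝ ∞ H ∧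
      ContDiff ℝ ∞ H.symm ∧ (∀ x : ℝ × ℝ, x.2 ≤ 0 → H x = x) ∧
      ∃ W' ⊆ W, IsAdjacentDomain I W' ∧ (∀ x ∈ W', ContDiffAt ℝ ∞ v x) ∧
        (∀ x ∈ W' ∪ bdry I, H x = (x.1 + v x, f x)) ∧
        ∀ x ∈ W' ∪ bdry I, F x ∈ W' ∪ bdry I → H (F x) = shear (H x) := by
  set a := zeroExt fun x => (F x).1 - (x.1 + x.2) with ha
  set b := zeroExt fun x => (F x).2 - x.2 with hb
  set u := zeroExt fun x => f x - x.2 with hu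
  have hag : FlatGerm I a := h1.flatGerm hI hW
  have hbg : FlatGerm I b := h2.flatGerm hI hW
  have hug : FlatGerm I u := hf.flat.flatGerm hI hW
  obtain ⟨v, hv, hveq⟩ := exists_flatGerm_coboundary hI hag hbg (hug.sub hag)
  obtain ⟨H, hHs, hHs', hH0, hHeq⟩ := hv.exists_homeomorph hI hug
  obtain ⟨W', hWW, hW', hp⟩ := hW.exists_subset hI hIc hIn
    (p := fun x => v (x.1 + x.2 + a x, x.2 + b x) = v x + (u x - a x) ∧
      ContDiffAt ℝ ∞ v x ∧ H x = (x.1 + v x, x.2 + u x))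
    fun t ht => by
      filter_upwards [hveq t ht, hv.smooth t ht, hHeq t ht] with x e1 e2 e3 h0
        using ⟨(e1 h0).2, e2, e3⟩
  have hHx : ∀ x ∈ W' ∪ bdry I, H x = (x.1 + v x, f x) := by
    rintro x (hx | hx)
    · have eu : u x = f x - x.2 := zeroExt_of_pos (hW'.pos x hx)
      rw [(hp x hx).2.2, eu]; ext <;> simp
    · have ef : f x - x.2 = 0 := hf.flat.zero x hx
      rw [hH0 x hx.2.le, hv.zero x hx.2.le]
      ext
      · simp
      · simp only; linarith
  refine ⟨v, H, hv, hHs, hHs', hH0, W', hWW, hW', fun x hx => (hp x hx).2.1, hHx, fun x hx hFx => ?_⟩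
  have hsub : W' ∪ bdry I ⊆ W ∪ bdry I := union_subset_union_left _ hWW
  rw [hHx x hx, hHx _ hFx, shear_apply, hf.invariant x (hsub hx) (hsub hFx)]
  rcases hx with hx | hx
  · have h0 := hW'.pos x hx
    have ea : a x = (F x).1 - (x.1 + x.2) := zeroExt_of_pos h0
    have eb : b x = (F x).2 - x.2 := zeroExt_of_pos h0
    have eu : u x = f x - x.2 := zeroExt_of_pos h0
    have e : (x.1 + x.2 + a x, x.2 + b x) = F x := by
      rw [ea, eb]; ext <;> simp
    have := (hp x hx).1
    rw [e] at this
    rw [this, eu, ea]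
    ext
    · simp only; ring
    · rfl
  · have ef : f x - x.2 = 0 := hf.flat.zero x hx
    have ex : x.2 = 0 := hx.2
    rw [apply_of_mem_bdry h1 h2 hx]
    ext
    · simp only; linarith
    · rfl

/-! ### Flat functions invariant under the shear -/

open Polynomial in
/-- The function `q(1/φ) exp(-1/φ) h(τ/φ)`, extended by zero to `φ ≤ 0`. For periodic `h` of period
one it is invariant under the shear; the polynomial factor `q` is there for derivatives. -/
noncomputable def flatWave (q : ℝ[X]) (h : ℝ → ℝ) (x : ℝ × ℝ) : ℝ :=
  q.eval x.2⁻¹ * expNegInvGlue x.2 * h (x.1 / x.2)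

section FlatWave

open Polynomial

theorem flatWave_of_nonpos (q : ℝ[X]) (h : ℝ → ℝ) {x : ℝ × ℝ} (hx : x.2 ≤ 0) :
    flatWave q h x = 0 := by
  rw [flatWave, expNegInvGlue.zero_of_nonpos hx, mul_zero, zero_mul]

theorem Function.Periodic.exists_abs_le {h : ℝ → ℝ} (hp : Function.Periodic h 1)
    (hc : Continuous h) : ∃ C, 0 ≤ C ∧ ∀ θ, |h θ| ≤ C := by
  obtain ⟨C, hC⟩ := (hp.isBounded_of_continuous one_ne_zero hc).exists_norm_le
  exact ⟨C, (norm_nonneg _).trans (hC (h 0) ⟨0, rfl⟩), fun θ => hC _ ⟨θ, rfl⟩⟩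

theorem Function.Periodic.deriv_periodic {h : ℝ → ℝ} {c : ℝ} (hp : Function.Periodic h c) :
    Function.Periodic (deriv h) c := by
  intro x
  have : (fun y => h (y + c)) = h := funext hp
  rw [← deriv_comp_add_const, this]

theorem hasFDerivAt_flatWave (q : ℝ[X]) {h : ℝ → ℝ} (hd : Differentiable ℝ h)
    (hp : Function.Periodic h 1) (x : ℝ × ℝ) :
    HasFDerivAt (flatWave q h)
      (flatWave (X * q) (deriv h) x • ContinuousLinearMap.fst ℝ ℝ ℝ +
        (flatWave (X ^ 2 * (q - derivative q)) h x - x.1 * flatWave (X ^ 2 * q) (deriv h) x) •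
          ContinuousLinearMap.snd ℝ ℝ ℝ) x := by
  rcases lt_trichotomy x.2 0 with h0 | h0 | h0
  · simp only [flatWave_of_nonpos _ _ h0.le, mul_zero, sub_zero, zero_smul, add_zero]
    refine (hasFDerivAt_const (0 : ℝ) x).congr_of_eventuallyEq ?_
    filter_upwards [continuous_snd.continuousAt.eventually_lt_const h0] with y hy
    exact flatWave_of_nonpos _ _ (le_of_lt hy)
  · simp only [flatWave_of_nonpos _ _ h0.le, mul_zero, sub_zero, zero_smul, add_zero]
    obtain ⟨C, hC0, hC⟩ := hp.exists_abs_le hd.continuous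
    have hcont := (expNegInvGlue.continuous_polynomial_eval_inv_mul (X ^ 2 * q)).abs
    have hb : ∀ᶠ y in 𝓝 x,
        |(X ^ 2 * q).eval y.2⁻¹ * expNegInvGlue y.2| < 1 := by
      have hc2 : Continuous fun y : ℝ × ℝ => |(X ^ 2 * q).eval y.2⁻¹ * expNegInvGlue y.2| :=
        hcont.comp continuous_snd
      refine hc2.continuousAt.eventually_lt_const ?_
      simp [h0]
    have hO : flatWave q h =O[𝓝 x] fun y => ‖y - x‖ ^ 2 := by
      refine Asymptotics.IsBigO.of_bound C ?_
      filter_upwards [hb] with y hy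
      rw [norm_pow, norm_norm, Real.norm_eq_abs]
      by_cases hy0 : y.2 = 0
      · rw [flatWave_of_nonpos _ _ hy0.le, abs_zero]; positivity
      have e : flatWave q h y = ((X ^ 2 * q).eval y.2⁻¹ * expNegInvGlue y.2) * h (y.1 / y.2) *
          y.2 ^ 2 := by
        rw [flatWave]; simp only [eval_mul, eval_pow, eval_X]; field_simp
      rw [e, abs_mul, abs_mul, abs_of_nonneg (sq_nonneg y.2)]
      have h2 : y.2 ^ 2 ≤ ‖y - x‖ ^ 2 := by
        rw [← sq_abs]
        refine pow_le_pow_left₀ (abs_nonneg _) ?_ 2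
        have := norm_snd_le (y - x)
        rwa [Prod.snd_sub, h0, sub_zero] at this
      calc _ ≤ 1 * C * ‖y - x‖ ^ 2 := by
            gcongr
            exact hC _
        _ = _ := by ring
    exact hO.hasFDerivAt (by norm_num)
  · have d1 : HasFDerivAt (fun y : ℝ × ℝ => q.eval y.2⁻¹ * expNegInvGlue y.2) _ x :=
      (expNegInvGlue.hasDerivAt_polynomial_eval_inv_mul q x.2).comp_hasFDerivAt x
        (hasFDerivAt_snd (𝕜 := ℝ) (E := ℝ) (F := ℝ) (p := x))
    have d2 : HasFDerivAt (fun y : ℝ × ℝ => h (y.1 / y.2)) _ x :=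
      (hd (x.1 / x.2)).hasDerivAt.comp_hasFDerivAt x
        ((hasFDerivAt_fst (𝕜 := ℝ) (E := ℝ) (F := ℝ) (p := x)).mul
          ((hasDerivAt_inv h0.ne').comp_hasFDerivAt x
            (hasFDerivAt_snd (𝕜 := ℝ) (E := ℝ) (F := ℝ) (p := x))))
    refine (d1.mul d2).congr_fderiv ?_
    apply ContinuousLinearMap.ext
    intro w
    simp only [flatWave, eval_mul, eval_pow, eval_X, eval_sub, add_apply, smul_apply,
      ContinuousLinearMap.coe_fst', ContinuousLinearMap.coe_snd', smul_eq_mul]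
    field_simp
    ring

theorem contDiff_flatWave {h : ℝ → ℝ} (hs : ContDiff ℝ ∞ h) (hp : Function.Periodic h 1)
    (q : ℝ[X]) : ContDiff ℝ ∞ (flatWave q h) := by
  rw [contDiff_infty]
  intro k
  induction k generalizing q h with
  | zero =>
    exact contDiff_zero.mpr (continuous_iff_continuousAt.mpr fun x =>
      (hasFDerivAt_flatWave q (hs.differentiable (by simp)) hp x).continuousAt)
  | succ k ih =>
    have hs' : ContDiff ℝ ∞ (deriv h) := hs.deriv'
    have hp' := hp.deriv_periodic
    push_cast
    refine contDiff_succ_iff_hasFDerivAt.mpr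
      ⟨_, ?_, hasFDerivAt_flatWave q (hs.differentiable (by simp)) hp⟩
    exact ((ih hs' hp' _).smul contDiff_const).add
      (((ih hs hp _).sub (contDiff_fst.mul (ih hs' hp' _))).smul contDiff_const)

/-- A bound for the differential of `exp(-1/φ) h(τ/φ)` that is uniform over all `h` with `|h| ≤ 1`
and `|h'| ≤ 1`. -/
noncomputable def waveBound (x : ℝ × ℝ) : ℝ :=
  |X.eval x.2⁻¹ * expNegInvGlue x.2| + |(X ^ 2).eval x.2⁻¹ * expNegInvGlue x.2| * (1 + |x.1|)

theorem continuous_waveBound : Continuous waveBound := by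
  have h1 : Continuous fun x : ℝ × ℝ => (X : ℝ[X]).eval x.2⁻¹ * expNegInvGlue x.2 :=
    (expNegInvGlue.continuous_polynomial_eval_inv_mul X).comp continuous_snd
  have h2 : Continuous fun x : ℝ × ℝ => (X ^ 2 : ℝ[X]).eval x.2⁻¹ * expNegInvGlue x.2 :=
    (expNegInvGlue.continuous_polynomial_eval_inv_mul (X ^ 2)).comp continuous_snd
  exact h1.abs.add (h2.abs.mul (continuous_const.add continuous_fst.abs))

theorem waveBound_of_nonpos {x : ℝ × ℝ} (hx : x.2 ≤ 0) : waveBound x = 0 := by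
  simp [waveBound, expNegInvGlue.zero_of_nonpos hx]

theorem norm_fderiv_flatWave_le {h : ℝ → ℝ} (hd : Differentiable ℝ h)
    (hp : Function.Periodic h 1) (h1 : ∀ θ, |h θ| ≤ 1) (h2 : ∀ θ, |deriv h θ| ≤ 1) (x : ℝ × ℝ) :
    ‖fderiv ℝ (flatWave 1 h) x‖ ≤ waveBound x := by
  rw [(hasFDerivAt_flatWave 1 hd hp x).fderiv]
  have b1 : ∀ q : ℝ[X], |flatWave q h x| ≤ |q.eval x.2⁻¹ * expNegInvGlue x.2| := fun q => by
    rw [flatWave, abs_mul]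
    exact mul_le_of_le_one_right (abs_nonneg _) (h1 _)
  have b2 : ∀ q : ℝ[X], |flatWave q (deriv h) x| ≤ |q.eval x.2⁻¹ * expNegInvGlue x.2| := fun q => by
    rw [flatWave, abs_mul]
    exact mul_le_of_le_one_right (abs_nonneg _) (h2 _)
  have c1 := b2 (X * 1)
  have c2 := b1 (X ^ 2 * (1 - derivative 1))
  have c3 := b2 (X ^ 2 * 1)
  simp only [derivative_one, sub_zero, mul_one] at c1 c2 c3 ⊢
  refine (norm_add_le _ _).trans ?_
  rw [norm_smul, norm_smul]
  have n1 := ContinuousLinearMap.norm_fst_le ℝ ℝ ℝ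
  have n2 := ContinuousLinearMap.norm_snd_le ℝ ℝ ℝ
  rw [waveBound, mul_one_add]
  refine add_le_add ?_ ?_
  · exact (mul_le_of_le_one_right (norm_nonneg _) n1).trans c1
  · refine (mul_le_of_le_one_right (norm_nonneg _) n2).trans ?_
    refine (norm_sub_le _ _).trans (add_le_add c2 ?_)
    rw [norm_mul, mul_comm]
    exact mul_le_mul_of_nonneg_right c3 (abs_nonneg _)

theorem flatWave_shear {h : ℝ → ℝ} (hp : Function.Periodic h 1) (q : ℝ[X]) (x : ℝ × ℝ) :
    flatWave q h (shear x) = flatWave q h x := by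
  rw [shear_apply]
  by_cases h0 : x.2 = 0
  · rw [flatWave_of_nonpos _ _ h0.le, flatWave_of_nonpos (x := (x.1 + x.2, x.2)) _ _ h0.le]
  · have : (x.1 + x.2) / x.2 = x.1 / x.2 + 1 := by field_simp
    simp only [flatWave, this, hp (x.1 / x.2)]

end FlatWave

/-! ### Leaves of the perturbed foliations -/

theorem expNegInvGlue_le_sq {p : ℝ} (hp : 0 < p) : expNegInvGlue p ≤ 3 / 5 * p ^ 2 := by
  have e : expNegInvGlue p = Real.exp (-p⁻¹) := if_neg (not_le.mpr hp)
  have h1 : Real.exp 1 * (p⁻¹ / 2) ≤ Real.exp (p⁻¹ / 2) := by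
    have := Real.add_one_le_exp (p⁻¹ / 2 - 1)
    rw [Real.exp_sub, le_div_iff₀ (Real.exp_pos 1)] at this
    linarith
  have h2 : (13 / 5 : ℝ) ≤ Real.exp 1 := by linarith [Real.exp_one_gt_d9]
  have h3 : (0 : ℝ) < p⁻¹ := by positivity
  have h4 : 13 / 10 * p⁻¹ ≤ Real.exp (p⁻¹ / 2) := by nlinarith
  have h5 : (13 / 10 * p⁻¹) ^ 2 ≤ Real.exp p⁻¹ := by
    have : Real.exp p⁻¹ = Real.exp (p⁻¹ / 2) ^ 2 := by rw [← Real.exp_nat_mul]; congr 1; push_cast; ring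
    rw [this]
    exact pow_le_pow_left₀ (by positivity) h4 2
  rw [e, Real.exp_neg, inv_le_comm₀ (Real.exp_pos _) (by positivity)]
  refine le_trans ?_ h5
  rw [mul_pow, mul_inv, inv_pow]
  have : (0 : ℝ) < (p ^ 2)⁻¹ := by positivity
  nlinarith

theorem expNegInvGlue_le_one (p : ℝ) : expNegInvGlue p ≤ 1 := by
  rw [expNegInvGlue]
  split_ifs with h
  · exact zero_le_one
  · exact Real.exp_le_one_iff.mpr (neg_nonpos.mpr (inv_nonneg.mpr (not_le.mp h).le))

/-- `exp(-1/p)` is a contraction. -/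
theorem abs_expNegInvGlue_sub_le (p q : ℝ) :
    |expNegInvGlue p - expNegInvGlue q| ≤ 3 / 5 * |p - q| := by
  have hd : ∀ x, HasDerivAt expNegInvGlue ((x⁻¹) ^ 2 * expNegInvGlue x) x := by
    intro x
    have := expNegInvGlue.hasDerivAt_polynomial_eval_inv_mul 1 x
    simpa using this
  have hb : ∀ x ∈ (univ : Set ℝ), ‖deriv expNegInvGlue x‖ ≤ 3 / 5 := by
    intro x _
    rw [(hd x).deriv, Real.norm_eq_abs, abs_of_nonneg (mul_nonneg (sq_nonneg _) (expNegInvGlue.nonneg x))]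
    rcases le_or_gt x 0 with h0 | h0
    · rw [expNegInvGlue.zero_of_nonpos h0]; norm_num
    · have := expNegInvGlue_le_sq h0
      calc _ ≤ (x⁻¹) ^ 2 * (3 / 5 * x ^ 2) := by gcongr
        _ = 3 / 5 := by field_simp
  have := convex_univ.norm_image_sub_le_of_norm_deriv_le (f := expNegInvGlue) (x := q) (y := p)
    (fun x _ => (hd x).differentiableAt) hb (mem_univ _) (mem_univ _)
  simpa [Real.norm_eq_abs] using this

/-- The level curve `φ + exp(-1/φ) h(θ) = c` as a graph over the axis of `θ = τ/φ`. -/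
theorem exists_levelCurve {h : ℝ → ℝ} (hc : Continuous h) (h1 : ∀ θ, |h θ| ≤ 1) {c : ℝ}
    (hc0 : 0 < c) (hc8 : c ≤ 1 / 8) : ∃ p : ℝ → ℝ, Continuous p ∧
      ∀ θ, p θ + expNegInvGlue (p θ) * h θ = c ∧ 0 < p θ ∧ |p θ - c| ≤ 4 * c ^ 2 := by
  have hcont : ∀ θ, Continuous fun p => p + expNegInvGlue p * h θ := fun θ =>
    continuous_id.add ((expNegInvGlue.contDiff (n := 0)).continuous.mul continuous_const)
  have hex : ∀ θ, ∃ p, p + expNegInvGlue p * h θ = c := by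
    intro θ
    have hle : ∀ p, |expNegInvGlue p * h θ| ≤ 1 := fun p => by
      rw [abs_mul, abs_of_nonneg (expNegInvGlue.nonneg p)]
      exact mul_le_one₀ (expNegInvGlue_le_one p) (abs_nonneg _) (h1 θ)
    have i1 := abs_le.mp (hle (c - 1))
    have i2 := abs_le.mp (hle (c + 1))
    obtain ⟨p, -, hp⟩ := intermediate_value_Icc (show c - 1 ≤ c + 1 by linarith)
      (hcont θ).continuousOn (show c ∈ Icc _ _ from ⟨by linarith, by linarith⟩)
    exact ⟨p, hp⟩
  choose p hp using hex
  have hdiff : ∀ θ θ', |p θ - p θ'| ≤ 5 / 2 * |h θ - h θ'| := by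
    intro θ θ'
    have e : p θ - p θ' = -((expNegInvGlue (p θ) - expNegInvGlue (p θ')) * h θ) -
        expNegInvGlue (p θ') * (h θ - h θ') := by linarith [hp θ, hp θ']
    have b1 : |(expNegInvGlue (p θ) - expNegInvGlue (p θ')) * h θ| ≤ 3 / 5 * |p θ - p θ'| := by
      rw [abs_mul]
      exact (mul_le_of_le_one_right (abs_nonneg _) (h1 θ)).trans (abs_expNegInvGlue_sub_le _ _)
    have b2 : |expNegInvGlue (p θ') * (h θ - h θ')| ≤ |h θ - h θ'| := by
      rw [abs_mul, abs_of_nonneg (expNegInvGlue.nonneg _)]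
      exact mul_le_of_le_one_left (abs_nonneg _) (expNegInvGlue_le_one _)
    have := abs_sub (-((expNegInvGlue (p θ) - expNegInvGlue (p θ')) * h θ))
      (expNegInvGlue (p θ') * (h θ - h θ'))
    rw [← e, abs_neg] at this
    linarith
  refine ⟨p, ?_, fun θ => ?_⟩
  · rw [continuous_iff_continuousAt]
    intro θ
    refine tendsto_iff_dist_tendsto_zero.mpr ?_
    have hh : Filter.Tendsto (fun s => 5 / 2 * |h s - h θ|) (𝓝 θ) (𝓝 0) := by
      have : Continuous fun s => 5 / 2 * |h s - h θ| := by fun_prop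
      simpa using this.tendsto θ
    exact squeeze_zero (fun _ => dist_nonneg) (fun s => hdiff s θ) hh
  · have e := hp θ
    have hh := abs_le.mp (h1 θ)
    have hn := expNegInvGlue.nonneg (p θ)
    have hpos : 0 < p θ := by
      by_contra! h0
      rw [expNegInvGlue.zero_of_nonpos h0] at e
      linarith
    have hsq := expNegInvGlue_le_sq hpos
    have hlin : expNegInvGlue (p θ) ≤ 3 / 5 * p θ := by
      have := abs_expNegInvGlue_sub_le (p θ) 0
      rw [expNegInvGlue.zero, sub_zero, sub_zero, abs_of_pos hpos, abs_of_nonneg hn] at this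
      exact this
    have hup : p θ ≤ 5 / 2 * c := by nlinarith
    refine ⟨e, hpos, ?_⟩
    have e' : p θ - c = -(expNegInvGlue (p θ) * h θ) := by linarith
    rw [e', abs_neg, abs_mul, abs_of_nonneg hn]
    calc _ ≤ 3 / 5 * p θ ^ 2 * 1 := by gcongr; exact h1 θ
      _ ≤ 3 / 5 * (5 / 2 * c) ^ 2 * 1 := by gcongr
      _ ≤ 4 * c ^ 2 := by nlinarith [sq_nonneg c]

/-- The family of flat integrals `φ~ + exp(-1/φ~) h(τ~/φ~)`, where `H = (τ~, φ~)`. -/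
noncomputable def waveIntegral (H : ℝ × ℝ → ℝ × ℝ) (h : ℝ → ℝ) (x : ℝ × ℝ) : ℝ :=
  (H x).2 + flatWave 1 h (H x)

theorem exists_int_mul_near (t : ℝ) {c : ℝ} (hc : 0 < c) : ∃ n : ℤ, |n * c - t| ≤ c ∧
    |(n : ℝ)| * c ≤ |t| + c := by
  have h1 := Int.floor_le (t / c)
  have h2 := Int.lt_floor_add_one (t / c)
  rw [le_div_iff₀ hc] at h1
  rw [div_lt_iff₀ hc] at h2
  have h3 : |(⌊t / c⌋ : ℝ) * c - t| ≤ c := by rw [abs_le]; constructor <;> linarith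
  refine ⟨⌊t / c⌋, h3, ?_⟩
  have h4 : |(⌊t / c⌋ : ℝ)| * c = |(⌊t / c⌋ : ℝ) * c| := by rw [abs_mul, abs_of_pos hc]
  rw [h4]
  have := abs_add_le ((⌊t / c⌋ : ℝ) * c - t) t
  rw [sub_add_cancel] at this
  linarith

/-- Integrals of the family with the same germ of foliation at one boundary point coincide: a leaf
near that point runs through a full period of `θ = τ~/φ~`, and on the leaf through a point with
integer `θ` both integrals are equal to one and the same constant. -/
theorem eq_of_sameFoliationGerm {I : Set ℝ} {W : Set (ℝ × ℝ)} (hW : IsAdjacentDomain I W)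
    (H : (ℝ × ℝ) ≃ₜ (ℝ × ℝ)) (hH0 : ∀ x : ℝ × ℝ, x.2 ≤ 0 → H x = x) {h₁ h₂ : ℝ → ℝ}
    (hc : Continuous h₁) (hb : ∀ θ, |h₁ θ| ≤ 1) (hp₁ : Function.Periodic h₁ 1)
    (hp₂ : Function.Periodic h₂ 1) (h10 : h₁ 0 = 0) (h20 : h₂ 0 = 0) {x : ℝ × ℝ}
    (hx : x ∈ bdry I)
    (hg : SameFoliationGerm (W ∪ bdry I) (waveIntegral H h₁) (waveIntegral H h₂) x) : h₁ = h₂ := by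
  obtain ⟨U, hU, hxU, hleaf⟩ := hg
  have hxe : x = (x.1, 0) := Prod.ext rfl hx.2
  set t := x.1 with ht
  have hsymm : H.symm (t, 0) = (t, 0) := by
    rw [Homeomorph.symm_apply_eq, hH0 _ le_rfl]
  have hsymm_pos : ∀ y : ℝ × ℝ, 0 < y.2 → 0 < (H.symm y).2 := by
    intro y hy
    by_contra! h0
    have h1 := hH0 _ h0
    rw [Homeomorph.apply_symm_apply] at h1
    rw [← h1] at h0
    exact absurd hy (not_lt.mpr h0)
  have hcS : Filter.Tendsto H.symm (𝓝 (t, 0)) (𝓝 ((t, 0) : ℝ × ℝ)) := by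
    have := H.symm.continuous.tendsto (t, 0)
    rwa [hsymm] at this
  have hev : ∀ᶠ z in 𝓝 ((t, 0) : ℝ × ℝ), z ∈ U ∧ (0 < z.2 → z ∈ W) :=
    (hU.eventually_mem (hxe ▸ hxU)).and (hW.eventually_mem hx.1)
  obtain ⟨r, hr, hball⟩ := Metric.eventually_nhds_iff.mp (hcS.eventually hev)
  have hS : ∀ y : ℝ × ℝ, dist y (t, 0) < r → 0 < y.2 → H.symm y ∈ (W ∪ bdry I) ∩ U := fun y hy h0 =>
    ⟨Or.inl ((hball hy).2 (hsymm_pos y h0)), (hball hy).1⟩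
  -- a leaf close to the boundary point, and a point of it with integer `θ`
  obtain ⟨c, hc0, hcr⟩ : ∃ c, 0 < c ∧ c * (8 + r + 4 * |t|) < min 1 r :=
    ⟨min 1 r / (2 * (8 + r + 4 * |t|)), by positivity, by
      have : 0 < min 1 r := by positivity
      field_simp
      linarith⟩
  rw [lt_min_iff] at hcr
  have hct : 0 ≤ c * |t| := by positivity
  have hc8 : c ≤ 1 / 8 := by nlinarith [mul_pos hc0 hr]
  obtain ⟨p, hpc, hp⟩ := exists_levelCurve hc hb hc0 hc8
  obtain ⟨n, hn1, hn2⟩ := exists_int_mul_near t hc0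
  set γ : ℝ → ℝ × ℝ := fun θ => H.symm (θ * p θ, p θ) with hγ
  have hγc : Continuous γ := H.symm.continuous.comp ((continuous_id.mul hpc).prodMk hpc)
  have hwave : ∀ (h : ℝ → ℝ) (θ : ℝ), waveIntegral H h (γ θ) =
      p θ + expNegInvGlue (p θ) * h θ := by
    intro h θ
    rw [waveIntegral, hγ]
    simp only [Homeomorph.apply_symm_apply, flatWave, Polynomial.eval_one, one_mul]
    rw [mul_div_assoc, div_self (hp θ).2.1.ne', mul_one]
  have hdist : ∀ θ ∈ Icc (n : ℝ) (n + 1), dist ((θ * p θ, p θ) : ℝ × ℝ) (t, 0) < r := by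
    intro θ hθ
    obtain ⟨-, q1, q2⟩ := hp θ
    have hθn : |θ - n| ≤ 1 := by rw [abs_le]; constructor <;> linarith [hθ.1, hθ.2]
    have hθa : |θ| * c ≤ |t| + 2 * c := by
      have := abs_add_le (θ - n) n
      rw [sub_add_cancel] at this
      nlinarith
    have hcc : 4 * c ^ 2 ≤ c / 2 := by nlinarith
    rw [Prod.dist_eq]
    refine max_lt ?_ ?_
    · rw [Real.dist_eq]
      have e : θ * p θ - t = θ * (p θ - c) + (θ - n) * c + (n * c - t) := by ring
      have a1 : |θ * (p θ - c)| ≤ (|t| + 2 * c) * (4 * c) := by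
        rw [abs_mul]
        calc _ ≤ |θ| * (4 * c ^ 2) := by gcongr
          _ = |θ| * c * (4 * c) := by ring
          _ ≤ _ := by gcongr
      have a2 : |(θ - n) * c| ≤ c := by
        rw [abs_mul, abs_of_pos hc0]; nlinarith
      have a3 := abs_add_three (θ * (p θ - c)) ((θ - n) * c) (n * c - t)
      rw [← e] at a3
      nlinarith [mul_pos hc0 hr]
    · rw [Real.dist_eq, sub_zero, abs_of_pos q1]
      have := (abs_le.mp q2).2
      nlinarith [mul_pos hc0 hr]
  have hγS : ∀ θ ∈ Icc (n : ℝ) (n + 1), γ θ ∈ (W ∪ bdry I) ∩ U := fun θ hθ =>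
    hS _ (hdist θ hθ) (hp θ).2.1
  have hnI : (n : ℝ) ∈ Icc (n : ℝ) (n + 1) := ⟨le_rfl, by linarith⟩
  have hn10 : h₁ n = 0 := by
    have := hp₁.int_mul_eq n
    rw [mul_one] at this
    rw [this, h10]
  have hn20 : h₂ n = 0 := by
    have := hp₂.int_mul_eq n
    rw [mul_one] at this
    rw [this, h20]
  have hK : γ '' Icc (n : ℝ) (n + 1) ⊆
      leafThrough ((W ∪ bdry I) ∩ U) (waveIntegral H h₁) (γ n) := by
    refine (isPreconnected_Icc.image γ hγc.continuousOn).subset_connectedComponentIn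
      ⟨n, hnI, rfl⟩ ?_
    rintro _ ⟨θ, hθ, rfl⟩
    refine ⟨hγS θ hθ, ?_⟩
    rw [hwave, hwave, (hp θ).1, (hp n).1]
  rw [hleaf _ (hγS n hnI)] at hK
  have hK2 : ∀ θ ∈ Icc (n : ℝ) (n + 1), waveIntegral H h₂ (γ θ) = waveIntegral H h₂ (γ n) :=
    fun θ hθ => (connectedComponentIn_subset _ _ (hK ⟨θ, hθ, rfl⟩)).2
  have heq : ∀ θ ∈ Icc (n : ℝ) (n + 1), h₁ θ = h₂ θ := by
    intro θ hθ
    have e1 := hK2 θ hθ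
    have e2 := (hp θ).1
    have e3 := (hp n).1
    rw [hwave, hwave, hn20] at e1
    rw [hn10] at e3
    have e4 : expNegInvGlue (p θ) * (h₁ θ - h₂ θ) = 0 := by linarith
    rcases mul_eq_zero.mp e4 with h | h
    · exact absurd h (expNegInvGlue.pos_of_pos (hp θ).2.1).ne'
    · linarith
  ext θ
  obtain ⟨y, hy, hy1⟩ := (hp₁.sub hp₂).exists_mem_Ico one_pos θ n
  have := heq y ⟨hy.1, hy.2.le⟩
  simp only [Pi.sub_apply] at hy1
  linarith

/-! ### The infinite-dimensional family -/

/-- The admissible profiles: smooth functions of period one vanishing at `0`, normalized so that one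
domain `W` serves all of them. -/
structure IsProfile (h : ℝ → ℝ) : Prop where
  smooth : ContDiff ℝ ∞ h
  periodic : Function.Periodic h 1
  zero : h 0 = 0
  abs_le : ∀ θ, |h θ| ≤ 1
  abs_deriv_le : ∀ θ, |deriv h θ| ≤ 1

/-- All profiles give flat integrals on one and the same adjacent domain. -/
theorem exists_forall_isFlatIntegral_waveIntegral {F : ℝ × ℝ → ℝ × ℝ} {I : Set ℝ} (hI : IsOpen I)
    (hIc : I.OrdConnected) (hIn : I.Nonempty) {W : Set (ℝ × ℝ)} (hW : IsAdjacentDomain I W)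
    (H : (ℝ × ℝ) ≃ₜ (ℝ × ℝ)) (hH : ContDiff ℝ ∞ H) (hH0 : ∀ x : ℝ × ℝ, x.2 ≤ 0 → H x = x)
    (hconj : ∀ x ∈ W ∪ bdry I, F x ∈ W ∪ bdry I → H (F x) = shear (H x)) :
    ∃ W' ⊆ W, IsAdjacentDomain I W' ∧ ∀ h, IsProfile h →
      IsFlatIntegral F I W' (waveIntegral H h) := by
  set d : ℝ × ℝ → ℝ := fun x => (H x).2 - x.2 with hd
  have hds : ContDiff ℝ ∞ d := (contDiff_snd.comp hH).sub contDiff_snd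
  have hdg : FlatGerm I d := ⟨fun x hx => by simp only [hd]; rw [hH0 x hx, sub_self],
    fun t _ => Filter.Eventually.of_forall fun _ => hds.contDiffAt⟩
  have hB : Continuous fun x => waveBound (H x) * ‖fderiv ℝ H x‖ :=
    (continuous_waveBound.comp H.continuous).mul (hH.continuous_fderiv (by simp)).norm
  obtain ⟨W', hWW, hW', hp⟩ := hW.exists_subset hI hIc hIn
    (p := fun x => ‖fderiv ℝ d x‖ < 1 / 2 ∧ waveBound (H x) * ‖fderiv ℝ H x‖ < 1 / 2)
    fun t ht => by
      have e : waveBound (H (t, 0)) * ‖fderiv ℝ H (t, 0)‖ < 1 / 2 := by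
        rw [hH0 _ le_rfl, waveBound_of_nonpos le_rfl, zero_mul]; norm_num
      filter_upwards [hdg.eventually_norm_fderiv_lt (by norm_num : (0 : ℝ) < 1 / 2) ht,
        hB.continuousAt.eventually_lt_const e] with x e1 e2 _ using ⟨e1, e2⟩
  refine ⟨W', hWW, hW', fun h hh => ?_⟩
  have hw : ContDiff ℝ ∞ (flatWave 1 h) := contDiff_flatWave hh.smooth hh.periodic 1
  have hwH : ContDiff ℝ ∞ fun x => flatWave 1 h (H x) := hw.comp hH
  have hu : ContDiff ℝ ∞ fun x => d x + flatWave 1 h (H x) := hds.add hwH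
  have e : waveIntegral H h = fun x => x.2 + (d x + flatWave 1 h (H x)) := by
    ext x; simp only [waveIntegral, hd]; ring
  have hug : FlatGerm I fun x => d x + flatWave 1 h (H x) :=
    ⟨fun x hx => by rw [hdg.zero x hx, hH0 x hx, flatWave_of_nonpos _ _ hx, add_zero],
      fun t _ => Filter.Eventually.of_forall fun _ => hu.contDiffAt⟩
  rw [e]
  refine hug.isFlatIntegral hW' (fun x _ => hu.contDiffAt) (fun x hx => ?_) ?_
  · have hdx : DifferentiableAt ℝ (flatWave 1 h) (H x) := hw.differentiable (by simp) _
    have hHx : DifferentiableAt ℝ H x := hH.differentiable (by simp) _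
    rw [fderiv_fun_add (hds.differentiable (by simp) x) (hwH.differentiable (by simp) x)]
    have e2 : fderiv ℝ (fun x => flatWave 1 h (H x)) x =
        (fderiv ℝ (flatWave 1 h) (H x)).comp (fderiv ℝ H x) := fderiv_comp x hdx hHx
    have h1 := norm_fderiv_flatWave_le (hh.smooth.differentiable (by simp)) hh.periodic hh.abs_le
      hh.abs_deriv_le (H x)
    have h2 : ‖fderiv ℝ (fun x => flatWave 1 h (H x)) x‖ ≤ waveBound (H x) * ‖fderiv ℝ H x‖ := by
      rw [e2]
      exact (ContinuousLinearMap.opNorm_comp_le _ _).trans (by gcongr)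
    have := norm_add_le (fderiv ℝ d x) (fderiv ℝ (fun x => flatWave 1 h (H x)) x)
    linarith [(hp x hx).1, (hp x hx).2]
  · have hsub : W' ∪ bdry I ⊆ W ∪ bdry I := union_subset_union_left _ hWW
    rw [← e]
    intro x hx hFx
    rw [waveIntegral, hconj x (hsub hx) (hsub hFx), flatWave_shear hh.periodic]
    rfl

theorem mk_isProfile_le : #{h : ℝ → ℝ | IsProfile h} ≤ 𝔠 := by
  have hinj : Function.Injective
      (fun (h : {h : ℝ → ℝ | IsProfile h}) (q : ℚ) => (h : ℝ → ℝ) q) := by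
    intro h₁ h₂ he
    refine Subtype.ext (Continuous.ext_on Rat.denseRange_cast h₁.2.smooth.continuous
      h₂.2.smooth.continuous ?_)
    rintro _ ⟨q, rfl⟩
    exact congrFun he q
  refine (Cardinal.mk_le_of_injective hinj).trans (le_of_eq ?_)
  simp [Cardinal.mk_real]

/-- The polynomial profile `κ ∑ c_k sin(2πθ)^(k+1)`; the constant `κ` depends on `N` only and makes
it admissible for coefficients in `[0, 1]`. -/
noncomputable def sineProfile {N : ℕ} (c : Fin N → ℝ) (θ : ℝ) : ℝ :=
  ∑ k : Fin N, c k * (1 / (7 * (N + 1) ^ 2) * Real.sin (2 * Real.pi * θ) ^ ((k : ℕ) + 1))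

theorem periodic_sin_pow (κ : ℝ) (m : ℕ) :
    Function.Periodic (fun θ => κ * Real.sin (2 * Real.pi * θ) ^ m) 1 := by
  intro θ
  simp only
  rw [mul_add, mul_one, Real.sin_add_two_pi]

theorem contDiff_sin_pow (κ : ℝ) (m : ℕ) :
    ContDiff ℝ ∞ (fun θ => κ * Real.sin (2 * Real.pi * θ) ^ m) :=
  contDiff_const.mul ((Real.contDiff_sin.comp (contDiff_const.mul contDiff_id)).pow m)

theorem isProfile_sineProfile {N : ℕ} {c : Fin N → ℝ} (hc : c ∈ Icc (0 : Fin N → ℝ) 1) :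
    IsProfile (sineProfile c) := by
  set κ : ℝ := 1 / (7 * (N + 1) ^ 2) with hκ
  have hκ0 : 0 < κ := by positivity
  have hN : (0 : ℝ) ≤ N := Nat.cast_nonneg N
  have hκN : N * (κ * (7 * N)) ≤ 1 := by
    rw [hκ]
    have : (N : ℝ) * (1 / (7 * (N + 1) ^ 2) * (7 * N)) = N ^ 2 / (N + 1) ^ 2 := by field_simp
    rw [this, div_le_one (by positivity)]
    nlinarith
  have hc1 : ∀ k, |c k| ≤ 1 := fun k => by
    rw [abs_of_nonneg (hc.1 k)]; exact hc.2 k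
  have hsin : ∀ θ (m : ℕ), |Real.sin (2 * Real.pi * θ) ^ m| ≤ 1 := fun θ m => by
    rw [abs_pow]; exact pow_le_one₀ (abs_nonneg _) (Real.abs_sin_le_one _)
  have hsum : ∀ a : Fin N → ℝ, (∀ k, |a k| ≤ κ * (7 * N)) → |∑ k, a k| ≤ 1 := by
    intro a ha
    refine (Finset.abs_sum_le_sum_abs _ _).trans ((Finset.sum_le_sum fun k _ => ha k).trans ?_)
    rw [Finset.sum_const, Finset.card_univ, Fintype.card_fin, nsmul_eq_mul]
    exact hκN
  have hder : ∀ θ, HasDerivAt (sineProfile c) (∑ k : Fin N, c k * (κ * ((((k : ℕ) + 1 : ℕ) : ℝ) *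
      Real.sin (2 * Real.pi * θ) ^ (k : ℕ) * (Real.cos (2 * Real.pi * θ) * (2 * Real.pi))))) θ := by
    intro θ
    refine HasDerivAt.fun_sum fun k _ => ?_
    have h1 : HasDerivAt (fun θ : ℝ => 2 * Real.pi * θ) (2 * Real.pi) θ := by
      simpa using (hasDerivAt_id θ).const_mul (2 * Real.pi)
    exact (((h1.sin.pow _).const_mul κ).const_mul (c k))
  refine ⟨ContDiff.sum fun k _ => contDiff_const.mul (contDiff_sin_pow _ _), fun θ => ?_, ?_,
    fun θ => hsum _ fun k => ?_, fun θ => ?_⟩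
  · exact Finset.sum_congr rfl fun k _ => congrArg (c k * ·) (periodic_sin_pow _ _ θ)
  · simp [sineProfile]
  · have hN1 : (1 : ℝ) ≤ N := by exact_mod_cast Nat.one_le_of_lt k.isLt
    rw [abs_mul, abs_mul, abs_of_pos hκ0]
    calc _ ≤ 1 * (κ * 1) := by gcongr; exacts [hc1 k, hsin θ _]
      _ ≤ κ * (7 * N) := by nlinarith
  · rw [(hder θ).deriv]
    refine hsum _ fun k => ?_
    have hkN : (((k : ℕ) + 1 : ℕ) : ℝ) ≤ N := by exact_mod_cast k.isLt
    rw [abs_mul, abs_mul, abs_mul, abs_mul, abs_mul, abs_of_pos hκ0, Nat.abs_cast,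
      abs_of_pos Real.two_pi_pos]
    have hpi : 2 * Real.pi ≤ 7 := by linarith [Real.pi_lt_d2]
    calc _ ≤ 1 * (κ * (N * 1 * (1 * 7))) := by
          gcongr
          exacts [hc1 k, hsin θ _, Real.abs_cos_le_one _]
      _ = _ := by ring

open Polynomial in
/-- Coefficients are determined by the profile, because `sin` takes infinitely many values. -/
theorem sineProfile_injective {N : ℕ} :
    Function.Injective (sineProfile : (Fin N → ℝ) → ℝ → ℝ) := by
  intro c c' he
  set P : (Fin N → ℝ) → ℝ[X] := fun c => ∑ k : Fin N, C (c k) * X ^ ((k : ℕ) + 1) with hP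
  have heval : ∀ (c : Fin N → ℝ) (θ : ℝ),
      sineProfile c θ = 1 / (7 * (N + 1) ^ 2) * (P c).eval (Real.sin (2 * Real.pi * θ)) := by
    intro c θ
    simp only [hP, sineProfile, eval_finsetSum, eval_mul, eval_C, eval_pow, eval_X, Finset.mul_sum]
    exact Finset.sum_congr rfl fun k _ => by ring
  have hPP : P c = P c' := by
    refine eq_of_infinite_eval_eq _ _ ((Icc_infinite (show (-1 : ℝ) < 1 by norm_num)).mono ?_)
    intro s hs
    have h := congrFun he (Real.arcsin s / (2 * Real.pi))
    rw [heval, heval, mul_div_cancel₀ _ Real.two_pi_pos.ne', Real.sin_arcsin hs.1 hs.2] at h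
    exact mul_left_cancel₀ (by positivity) h
  have hcoeff : ∀ (c : Fin N → ℝ) (j : Fin N), (P c).coeff ((j : ℕ) + 1) = c j := by
    intro c j
    simp only [hP, finsetSum_coeff, coeff_C_mul, coeff_X_pow]
    rw [Finset.sum_eq_single j]
    · simp
    · intro k _ hk
      rw [if_neg fun h => hk (Fin.ext (by omega)), mul_zero]
    · simp
  ext j
  rw [← hcoeff c j, hPP, hcoeff]

theorem contDiff_waveIntegral_sineProfile {H : ℝ × ℝ → ℝ × ℝ} (hH : ContDiff ℝ ∞ H) (N : ℕ) :
    ContDiff ℝ ∞ fun p : (Fin N → ℝ) × (ℝ × ℝ) => waveIntegral H (sineProfile p.1) p.2 := by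
  have e : (fun p : (Fin N → ℝ) × (ℝ × ℝ) => waveIntegral H (sineProfile p.1) p.2) = fun p =>
      (H p.2).2 + ∑ k : Fin N, p.1 k * flatWave 1
        (fun θ => 1 / (7 * (N + 1) ^ 2) * Real.sin (2 * Real.pi * θ) ^ ((k : ℕ) + 1)) (H p.2) := by
    ext p
    simp only [waveIntegral, flatWave, sineProfile, Finset.mul_sum]
    congr 1
    exact Finset.sum_congr rfl fun k _ => by ring
  rw [e]
  have hH2 : ContDiff ℝ ∞ fun p : (Fin N → ℝ) × (ℝ × ℝ) => H p.2 := hH.comp contDiff_snd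
  refine (contDiff_snd.comp hH2).add (ContDiff.sum fun k _ => ContDiff.mul ?_ ?_)
  · exact (contDiff_apply ℝ ℝ k).comp contDiff_fst
  · exact (contDiff_flatWave (contDiff_sin_pow _ _) (periodic_sin_pow _ _) 1).comp hH2

theorem theorem1p14 (I : Set ℝ) (hI_open : IsOpen I) (hI_conn : I.OrdConnected)
    (hI_ne : I.Nonempty) (V : Set (ℝ × ℝ)) (hV : IsAdjacentDomain I V)
    (F : ℝ × ℝ → ℝ × ℝ) (hF_maps : ∀ x ∈ V ∪ bdry I, 0 ≤ (F x).2)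
    (hF_smooth : ContDiffOn ℝ ∞ F (V ∪ bdry I))
    (hF_fst : IsFlat I V (fun x => (F x).1 - (x.1 + x.2)))
    (hF_snd : IsFlat I V (fun x => (F x).2 - x.2)) :
    (∃ W ⊆ V, IsAdjacentDomain I W ∧ ∃ f : ℝ × ℝ → ℝ, IsFlatIntegral F I W f) ∧
    (∀ W ⊆ V, IsAdjacentDomain I W → ∀ f : ℝ × ℝ → ℝ, IsFlatIntegral F I W f →
      ∃ W' ⊆ W, IsAdjacentDomain I W' ∧ ∃ t : ℝ × ℝ → ℝ,
        ContDiffOn ℝ ∞ t (W' ∪ bdry I) ∧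
        IsFlat I W' (fun x => t x - x.1) ∧
        IsSmoothDiffeoOn (fun x => (t x, f x)) (W' ∪ bdry I) ∧
        ∀ x ∈ W' ∪ bdry I, F x ∈ W' ∪ bdry I →
          (t (F x), f (F x)) = (t x + f x, f x)) ∧
    (∃ W ⊆ V, IsAdjacentDomain I W ∧ ∃ 𝒮 : Set (ℝ × ℝ → ℝ),
      #𝒮 = 𝔠 ∧ (∀ f ∈ 𝒮, IsFlatIntegral F I W f) ∧ IsInfDimFamily I W 𝒮) := by
  have part1 := exists_isFlatIntegral hI_open hI_conn hI_ne hV hF_fst hF_snd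
  refine ⟨part1, fun W hWV hW f hf => ?_, ?_⟩
  · obtain ⟨v, H, hv, hH, hHs, -, W', hWW, hW', hvs, hHx, hconj⟩ :=
      hf.exists_normal_form hI_open hI_conn hI_ne hW (hF_fst.mono hWV) (hF_snd.mono hWV)
    refine ⟨W', hWW, hW', fun x => x.1 + v x, contDiff_fst.contDiffOn.add (hv.contDiffOn hvs),
      hv.isFlat hW' hvs fun x _ => by ring, ⟨hH.contDiffOn.congr fun x hx => (hHx x hx).symm,
        H.symm, hHs.contDiffOn, fun x hx => ?_⟩, fun x hx hFx => ?_⟩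
    · change H.symm (x.1 + v x, f x) = x
      rw [← hHx x hx, H.symm_apply_apply]
    · have := hconj x hx hFx
      rwa [hHx x hx, hHx _ hFx] at this
  · obtain ⟨W₀, hW₀V, hW₀, f, hf⟩ := part1
    obtain ⟨v, H, -, hH, -, hH0, W₁, hW₁W, hW₁, -, -, hconj⟩ :=
      hf.exists_normal_form hI_open hI_conn hI_ne hW₀ (hF_fst.mono hW₀V) (hF_snd.mono hW₀V)
    obtain ⟨W, hWW₁, hW, hint⟩ := exists_forall_isFlatIntegral_waveIntegral hI_open hI_conn hI_ne
      hW₁ H hH hH0 hconj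
    have hdist : ∀ h₁ h₂, IsProfile h₁ → IsProfile h₂ → ∀ p ∈ bdry I,
        SameFoliationGerm (W ∪ bdry I) (waveIntegral H h₁) (waveIntegral H h₂) p → h₁ = h₂ :=
      fun h₁ h₂ p₁ p₂ p hp => eq_of_sameFoliationGerm hW H hH0 p₁.smooth.continuous p₁.abs_le
        p₁.periodic p₂.periodic p₁.zero p₂.zero hp
    obtain ⟨t, ht⟩ := hI_ne
    have hinj : ∀ h₁ h₂, IsProfile h₁ → IsProfile h₂ → waveIntegral H h₁ = waveIntegral H h₂ →
        h₁ = h₂ := fun h₁ h₂ p₁ p₂ he => hdist h₁ h₂ p₁ p₂ (t, 0) ⟨ht, rfl⟩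
      ⟨univ, isOpen_univ, mem_univ _, fun x _ => by rw [he]⟩
    refine ⟨W, hWW₁.trans (hW₁W.trans hW₀V), hW, waveIntegral H '' {h | IsProfile h}, le_antisymm
      (Cardinal.mk_image_le.trans mk_isProfile_le) ?_, ?_, ?_, fun N => ?_⟩
    · have hmem : ∀ c : Icc (0 : ℝ) 1, IsProfile (sineProfile fun _ : Fin 1 => (c : ℝ)) := fun c =>
        isProfile_sineProfile ⟨fun _ => c.2.1, fun _ => c.2.2⟩
      rw [← Cardinal.mk_Icc_real (zero_lt_one (α := ℝ))]
      refine Cardinal.mk_le_of_injective (f := fun c : Icc (0 : ℝ) 1 =>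
        (⟨_, mem_image_of_mem _ (hmem c)⟩ : waveIntegral H '' {h | IsProfile h})) fun c c' he => ?_
      have h1 := sineProfile_injective (hinj _ _ (hmem c) (hmem c') (congrArg Subtype.val he))
      exact Subtype.ext (congrFun h1 0)
    · rintro _ ⟨h, hh, rfl⟩
      exact hint h hh
    · rintro _ ⟨h₁, p₁, rfl⟩ _ ⟨h₂, p₂, rfl⟩ hne p hp hg
      exact hne (by rw [hdist h₁ h₂ p₁ p₂ p hp hg])
    · refine ⟨fun c => waveIntegral H (sineProfile c),
        fun c hc => mem_image_of_mem _ (isProfile_sineProfile hc), fun c hc c' hc' he => ?_,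
        (contDiff_waveIntegral_sineProfile hH N).contDiffOn⟩
      exact sineProfile_injective
        (hinj _ _ (isProfile_sineProfile hc) (isProfile_sineProfile hc') he)
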